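/- Let $\Delta=\sum_{m\ge 0}q^{(2m+1)^2}\in\mathbf F_2[[q]]$, i.e. the reduction mod $2$ of $q\prod_{n\ge1}(1-q^n)^{24}$, and let $\mathcal F\subset\mathbf F_2[[q]]$ be the $\mathbf F_2$-vector space with basis $\Delta,\Delta^3,\Delta^5,\dots$. The Hecke operator $T_5$ sends $\sum_n c(n)q^n$ to $\sum_n\gamma(n)q^n$, where $\gamma(n)=c(5n)$ if $5\nmid n$ and $\gamma(n)=c(5n)+c(n/5)$ if $5\mid n$. For an integer $k=\sum_{i\ge0}\beta_i2^i\ge 0$ with $\beta_i\in\{0,1\}$, put $$n_3(k)=\sum_{i\ge0}\beta_{2i+1}2^i,\qquad n_5(k)=\sum_{i\ge0}\beta_{2i+2}2^i,\qquad h(k)=n_3(k)+n_5(k),$$ and call $[n_3(k),n_5(k)]$ the code of $k$. For odd $k,\ell$ write $k\prec\ell$ if $h(k)<h(\ell)$, or $h(k)=h(\ell)$ and $n_5(k)<n_5(\ell)$; this is a strict total order on the odd positive integers. A nonzero $f\in\mathcal F$ is written uniquely as $f=\Delta^{m_1}+\dots+\Delta^{m_r}$ with $r\ge 1$, all $m_i$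 odd and $m_1\succ m_2\succ\dots\succ m_r$; $m_1$ is called the dominant exponent of $f$, and $h(f)=\max_i h(m_i)$. Put $h(0)=-\infty$. **Proposition.** Let $f\in\mathcal F$, $f\ne0$, and let $m_1$ be its dominant exponent. Then $T_5f\in\mathcal F$ and: (i) $h(T_5f)\le h(f)-1=h(m_1)-1$. (ii) If $n_5(m_1)\ge1$, then $h(T_5f)=h(m_1)-1$ (in particular $T_5f\neq0$), and the dominant exponent of $T_5f$ has code $[n_3(m_1),\,n_5(m_1)-1]$. -/

import Mathlib

namespace ModTwo

open PowerSeries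

/-- The series `Δ = ∑_{m ≥ 0} q^{(2m+1)²}` in `𝔽₂⟦q⟧`, which is the reduction mod 2 of the
discriminant series `q ∏ (1 - q^n)^24`. -/
noncomputable def Delta : PowerSeries (ZMod 2) :=
  open Classical in
  PowerSeries.mk fun n => if ∃ m : ℕ, n = (2 * m + 1) ^ 2 then 1 else 0

/-- The space `𝓕 ⊆ 𝔽₂⟦q⟧` spanned by `Δ, Δ³, Δ⁵, …`. -/
noncomputable def oddForms : Submodule (ZMod 2) (PowerSeries (ZMod 2)) :=
  Submodule.span (ZMod 2) (Set.range fun i : ℕ => Delta ^ (2 * i + 1))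

/-- The mod 2 Hecke operator `T_p` on `q`-expansions: the `n`-th coefficient of `T_p f` is
`c(pn)` if `p ∤ n` and `c(pn) + c(n/p)` if `p ∣ n`. -/
noncomputable def hecke (p : ℕ) (f : PowerSeries (ZMod 2)) : PowerSeries (ZMod 2) :=
  PowerSeries.mk fun n =>
    if p ∣ n then coeff (p * n) f + coeff (n / p) f else coeff (p * n) f

theorem X_dvd_Delta : ∃ u : PowerSeries (ZMod 2), Delta = X * u ∧ constantCoeff u = 1 := by
  have h0 : (X : PowerSeries (ZMod 2)) ∣ Delta := by
    rw [X_dvd_iff, ← coeff_zero_eq_constantCoeff_apply]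
    simp only [Delta, coeff_mk]
    rw [if_neg]
    rintro ⟨m, hm⟩
    have : 0 < (2 * m + 1) ^ 2 := by positivity
    omega
  obtain ⟨u, hu⟩ := h0
  refine ⟨u, hu, ?_⟩
  have h1 : coeff 1 Delta = (1 : ZMod 2) := by
    simp only [Delta, coeff_mk]
    rw [if_pos ⟨0, by norm_num⟩]
  rw [hu] at h1
  have h2 := coeff_succ_X_mul 0 u
  simp only [zero_add] at h2
  rw [h2] at h1
  simpa using h1

theorem coeff_Delta_pow_of_lt {n k : ℕ} (h : n < k) : coeff n (Delta ^ k) = 0 := by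
  obtain ⟨u, hu, -⟩ := X_dvd_Delta
  rw [hu, mul_pow, coeff_X_pow_mul', if_neg (by omega)]

theorem coeff_Delta_pow_self (k : ℕ) : coeff k (Delta ^ k) = 1 := by
  obtain ⟨u, hu, h1⟩ := X_dvd_Delta
  rw [hu, mul_pow, coeff_X_pow_mul', if_pos le_rfl]
  simp [h1]

/-- The odd powers of `Δ` are linearly independent, so that they form a basis of `𝓕`. -/
theorem linearIndependent_Delta_pow :
    LinearIndependent (ZMod 2) (fun i : ℕ => Delta ^ (2 * i + 1)) := by
  rw [linearIndependent_iff']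
  intro s g hg i
  induction i using Nat.strong_induction_on with
  | _ i ih =>
    intro hi
    have h := congrArg (coeff (2 * i + 1)) hg
    rw [map_sum, map_zero, Finset.sum_eq_single_of_mem i hi] at h
    · simpa [coeff_Delta_pow_self] using h
    · intro j hj hji
      rcases lt_or_gt_of_ne hji with hlt | hgt
      · rw [ih j hlt hj, zero_smul, map_zero]
      · rw [map_smul, coeff_Delta_pow_of_lt (by omega), smul_zero]

/-- The finite set of (odd) exponents `m` for which `Δ^m` occurs in `f ∈ 𝓕`. -/
noncomputable def exponents (f : oddForms) : Finset ℕ :=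
  (linearIndependent_Delta_pow.repr f).support.image fun i => 2 * i + 1

/-- `n₃(k) = ∑ β_{2i+1} 2^i`, where `k = ∑ β_i 2^i` in base 2
(the digits `β_{2i+1}` with `i ≥ k` vanish). -/
def n3 (k : ℕ) : ℕ := ∑ i ∈ Finset.range k, (k.testBit (2 * i + 1)).toNat * 2 ^ i

/-- `n₅(k) = ∑ β_{2i+2} 2^i`, where `k = ∑ β_i 2^i` in base 2. -/
def n5 (k : ℕ) : ℕ := ∑ i ∈ Finset.range k, (k.testBit (2 * i + 2)).toNat * 2 ^ i

/-- `h(k) = n₃(k) + n₅(k)`. -/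
def h (k : ℕ) : ℕ := n3 k + n5 k

/-- `ℓ` dominates `k` (used for `k`, `ℓ` of the same parity). -/
def DominatedBy (k l : ℕ) : Prop := h k < h l ∨ (h k = h l ∧ n5 k < n5 l)

/-- `m` is the dominant exponent of `f ∈ 𝓕`. -/
def IsDominantExponent (f : oddForms) (m : ℕ) : Prop :=
  m ∈ exponents f ∧ ∀ k ∈ exponents f, k ≠ m → DominatedBy k m

theorem bits_injective (n : ℕ) : ∀ a b : ℕ → Bool,
    ∑ i ∈ Finset.range n, (a i).toNat * 2 ^ i = ∑ i ∈ Finset.range n, (b i).toNat * 2 ^ i →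
      ∀ i < n, a i = b i := by
  induction n with
  | zero => intro a b _ i hi; omega
  | succ n ih =>
    intro a b hab
    have key : ∀ c : ℕ → Bool, ∑ i ∈ Finset.range (n + 1), (c i).toNat * 2 ^ i
        = 2 * (∑ i ∈ Finset.range n, (c (i + 1)).toNat * 2 ^ i) + (c 0).toNat := by
      intro c
      rw [Finset.sum_range_succ', Finset.mul_sum]
      simp only [pow_zero, mul_one, pow_succ]
      congr 1
      exact Finset.sum_congr rfl fun i _ => by ring
    rw [key a, key b] at hab
    have ha := Bool.toNat_lt (a 0)
    have hb := Bool.toNat_lt (b 0)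
    have h0 : (a 0).toNat = (b 0).toNat := by omega
    have h1 := ih (fun i => a (i + 1)) (fun i => b (i + 1)) (by omega)
    intro i hi
    cases i with
    | zero => revert h0; cases a 0 <;> cases b 0 <;> simp
    | succ i => exact h1 i (by omega)

theorem testBit_sum_extend (k N c : ℕ) (hN : k ≤ N) :
    ∑ i ∈ Finset.range k, (k.testBit (2 * i + c)).toNat * 2 ^ i
      = ∑ i ∈ Finset.range N, (k.testBit (2 * i + c)).toNat * 2 ^ i := by
  refine Finset.sum_subset (Finset.range_mono hN) fun i _ hi => ?_
  rw [Finset.mem_range, not_lt] at hi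
  have : k < 2 ^ (2 * i + c) :=
    lt_of_lt_of_le Nat.lt_two_pow_self (Nat.pow_le_pow_right (by norm_num) (by omega))
  rw [Nat.testBit_lt_two_pow this]
  simp

/-- An odd number is determined by its code `[n₃, n₅]`. -/
theorem code_injective {k l : ℕ} (hk : Odd k) (hl : Odd l) (h3 : n3 k = n3 l)
    (h5 : n5 k = n5 l) : k = l := by
  unfold n3 at h3
  unfold n5 at h5
  rw [testBit_sum_extend k (k + l) _ (by omega), testBit_sum_extend l (k + l) _ (by omega)] at h3 h5
  have b3 := bits_injective _ _ _ h3
  have b5 := bits_injective _ _ _ h5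
  refine Nat.eq_of_testBit_eq fun j => ?_
  rcases lt_or_ge j (k + l) with hj | hj
  · rcases Nat.even_or_odd' j with ⟨i, rfl | rfl⟩
    · cases i with
      | zero => simp [Nat.testBit_zero, Nat.odd_iff.mp hk, Nat.odd_iff.mp hl]
      | succ i => exact b5 i (by omega)
    · exact b3 i (by omega)
  · have hjj : j < 2 ^ j := Nat.lt_two_pow_self
    rw [Nat.testBit_lt_two_pow (by omega), Nat.testBit_lt_two_pow (by omega)]

/-- A nonzero form in `𝓕` has exactly one dominant exponent. -/
theorem existsUnique_isDominantExponent (f : oddForms) (hf : f ≠ 0) :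
    ∃! m, IsDominantExponent f m := by
  have hodd : ∀ k ∈ exponents f, Odd k := by
    intro k hk
    obtain ⟨i, -, rfl⟩ := Finset.mem_image.mp hk
    exact ⟨i, rfl⟩
  have hne : (exponents f).Nonempty := by
    refine Finset.Nonempty.image (Finsupp.support_nonempty_iff.mpr fun h0 => hf ?_) _
    have := linearIndependent_Delta_pow.linearCombination_repr f
    rw [h0, map_zero] at this
    exact Subtype.ext this.symm
  obtain ⟨m, hm, hmax⟩ :=
    Finset.exists_max_image (exponents f) (fun k => toLex (h k, n5 k)) hne
  refine ⟨m, ⟨hm, fun k hk hkm => ?_⟩, fun m' hm' => ?_⟩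
  · have hle := hmax k hk
    rw [Prod.Lex.le_iff] at hle
    simp only [ofLex_toLex] at hle
    rcases hle with hlt | ⟨heq, hle⟩
    · exact Or.inl hlt
    · refine Or.inr ⟨heq, lt_of_le_of_ne hle fun h5 => hkm ?_⟩
      refine code_injective (hodd k hk) (hodd m hm) ?_ h5
      unfold h at heq
      omega
  · by_contra hne'
    have h1 := hm'.2 m hm (Ne.symm hne')
    have h2 := hmax m' hm'.1
    rw [Prod.Lex.le_iff] at h2
    simp only [ofLex_toLex] at h2
    unfold DominatedBy at h1
    omega

/-- `h(f)` is the maximum of `h(m)` over the exponents `m` of `f`, and `h(0) = -∞`. -/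
noncomputable def hForm (f : oddForms) : WithBot ℤ :=
  (exponents f).sup fun m => ((h m : ℤ) : WithBot ℤ)

end ModTwo

/-! ### Parity of representation numbers of x² + 2y² and x² + 5y². -/

namespace ModTwo

open Finset

/-! Write A = Δ(q⁵). Everything rests on (Δ + A)⁶ = ΔA (`modular_equation`). With θ(q) = ∑ q^{x²}
over x ≡ 1 mod 6, one has θ³ = Δ(q³) and θ(q)θ(q⁵) = (Δ(q³) + Δ(q¹⁵))²; cubing the second identity
gives the modular equation in q³. Both identities are parity counts for x² + 2y² and x² + 5y².

T₅(Δ^k) is U₅(Δ^k) + A^k, where U₅ is linear over series in q⁵. The modular equation therefore gives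
a recursion of order 6, and T₅(Δ^k) is a polynomial p_k in Δ (`tpoly`). Frobenius gives p_{2k} =
p_k², and reading the equation as AΔ = ((Δ + A)³)² gives T₅(Δ^{2j+1}) = Δ R_j(Δ)² (`tpoly_odd`).
Iterating twice, R_{4i+d} is a monomial times a fourth power built from indices near i. This fits
the code: appending two binary digits to j doubles n₃ and n₅ of 2j+1 and adds one digit to each.

Index the exponent 2j+1 by j, with weights `wt` = n₃ + n₅ and `wt'` = n₃ + 2n₅. Induction on the
fourfold recursion shows that each degree a in R_j has wt a ≤ wt j − 1 and wt' a ≤ wt' j − 2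
(`rpoly_bound`), while the degree with code [n₃, n₅ − 1], attaining both bounds, does occur
(`exists_coeff_rpoly_eq_one`). Since wt' = wt + n₅, the two bounds together control the dominance
order, so lower terms of f cannot cancel the leading one. -/

theorem card_eq_zero_of_involution {α : Type*} (s : Finset α) (g : α → α)
    (hmem : ∀ a ∈ s, g a ∈ s) (hne : ∀ a ∈ s, g a ≠ a) (hinv : ∀ a ∈ s, g (g a) = a) :
    (#s : ZMod 2) = 0 := by
  have := Finset.sum_involution (s := s) (f := fun _ => (1 : ZMod 2)) (fun a _ => g a)
    (fun _ _ => CharTwo.add_self_eq_zero 1) (fun a ha _ => hne a ha) hmem hinv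
  simpa using this

/-- The representations `n = x² + d y²` with `x + y ≡ 1` modulo 3. -/
noncomputable def reps (d n : ℕ) : Finset (ℤ × ℤ) :=
  {z ∈ Icc (-n : ℤ) n ×ˢ Icc (-n : ℤ) n | z.1 ^ 2 + d * z.2 ^ 2 = n ∧ (z.1 + z.2) % 3 = 1}

theorem mem_Icc_of_mul_sq_le {d n : ℕ} (hd : 0 < d) {x : ℤ} (h : d * x ^ 2 ≤ n) :
    x ∈ Icc (-n : ℤ) n := by
  have hd' : (1 : ℤ) ≤ d := by exact_mod_cast hd
  have h1 : x ^ 2 ≤ n := by nlinarith [sq_nonneg x]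
  rw [Finset.mem_Icc]
  constructor <;> nlinarith [Int.le_self_sq x, Int.le_self_sq (-x)]

theorem mem_reps {d n : ℕ} (hd : 0 < d) {x y : ℤ} :
    (x, y) ∈ reps d n ↔ x ^ 2 + d * y ^ 2 = n ∧ (x + y) % 3 = 1 := by
  simp only [reps, Finset.mem_filter, Finset.mem_product, and_iff_right_iff_imp]
  rintro ⟨h, -⟩
  have hd' : (1 : ℤ) ≤ d := by exact_mod_cast hd
  refine ⟨mem_Icc_of_mul_sq_le one_pos ?_, mem_Icc_of_mul_sq_le hd ?_⟩
  · push_cast; nlinarith [sq_nonneg y]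
  · nlinarith [sq_nonneg x]

theorem emod_three_cases (x : ℤ) : x % 3 = 0 ∨ x % 3 = 1 ∨ x % 3 = 2 := by omega

theorem sq_emod_three (x : ℤ) : x ^ 2 % 3 = if x % 3 = 0 then 0 else 1 := by
  rcases emod_three_cases x with h | h | h <;> simp [pow_two, Int.mul_emod, h]

open Classical in
-- As 3 ∤ n, a root k is a unit mod 3, and the congruence selects exactly one of ±k.
theorem card_filter_mul_sq (d n : ℕ) (hd : 0 < d) (hn : ¬ 3 ∣ n) :
    (#((Icc (-n : ℤ) n).filter fun x : ℤ => (d : ℤ) * x ^ 2 = n ∧ x % 3 = 1) : ZMod 2) =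
      if ∃ k : ℕ, n = d * k ^ 2 then 1 else 0 := by
  split_ifs with h
  · obtain ⟨k, hk⟩ := h
    have hk3 : (k : ℤ) % 3 ≠ 0 := by
      intro h0
      apply hn
      have : 3 ∣ k := by omega
      rw [hk]
      exact dvd_mul_of_dvd_right (dvd_pow this two_ne_zero) _
    have hd' : (d : ℤ) ≠ 0 := by exact_mod_cast hd.ne'
    have hsq : ∀ x : ℤ, (d : ℤ) * x ^ 2 = n ↔ x = k ∨ x = -k := by
      intro x
      rw [hk]
      push_cast
      rw [mul_right_inj' hd', sq_eq_sq_iff_eq_or_eq_neg]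
    have hmem : ∀ x : ℤ, (d : ℤ) * x ^ 2 = n → x ∈ Icc (-n : ℤ) n := fun x hx =>
      mem_Icc_of_mul_sq_le hd hx.le
    have : #((Icc (-n : ℤ) n).filter fun x : ℤ => (d : ℤ) * x ^ 2 = n ∧ x % 3 = 1) = 1 := by
      rw [Finset.card_eq_one]
      rcases emod_three_cases k with h | h | h
      · exact absurd h hk3
      · refine ⟨(k : ℤ), ?_⟩
        ext x
        simp only [Finset.mem_filter, Finset.mem_singleton]
        constructor
        · rintro ⟨-, hx, hx3⟩
          rcases (hsq x).1 hx with rfl | rfl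
          · rfl
          · omega
        · rintro rfl
          exact ⟨hmem _ ((hsq _).2 (Or.inl rfl)), (hsq _).2 (Or.inl rfl), h⟩
      · refine ⟨-(k : ℤ), ?_⟩
        ext x
        simp only [Finset.mem_filter, Finset.mem_singleton]
        constructor
        · rintro ⟨-, hx, hx3⟩
          rcases (hsq x).1 hx with rfl | rfl
          · omega
          · rfl
        · rintro rfl
          exact ⟨hmem _ ((hsq _).2 (Or.inr rfl)), (hsq _).2 (Or.inr rfl), by omega⟩
    rw [this, Nat.cast_one]
  · have : #((Icc (-n : ℤ) n).filter fun x : ℤ => (d : ℤ) * x ^ 2 = n ∧ x % 3 = 1) = 0 := by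
      rw [Finset.card_eq_zero, Finset.filter_eq_empty_iff]
      rintro x - ⟨hx, -⟩
      refine h ⟨x.natAbs, ?_⟩
      zify
      rw [sq_abs, hx]
    rw [this, Nat.cast_zero]

open Classical in
-- Since x² + dy² ≡ x² − y² mod 3 is nonzero, exactly one coordinate is divisible by 3. Changing its
-- sign preserves x + y mod 3; the fixed solutions have a zero coordinate and yield the two
-- indicators.
theorem card_reps_of_not_dvd (d n : ℕ) (hd : d % 3 = 2) (hn : ¬ 3 ∣ n) :
    (#(reps d n) : ZMod 2) =
      (if ∃ k : ℕ, n = k ^ 2 then 1 else 0) + if ∃ k : ℕ, n = d * k ^ 2 then 1 else 0 := by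
  have hd0 : 0 < d := by omega
  have hn0 : (n : ℤ) ≠ 0 := by
    rintro h
    have : n = 0 := by exact_mod_cast h
    exact hn (this ▸ dvd_zero 3)
  have hmod : ∀ x y : ℤ, x ^ 2 + d * y ^ 2 = n → (x + y) % 3 = 1 →
      (x % 3 = 0 ∧ y % 3 = 1) ∨ (x % 3 = 1 ∧ y % 3 = 0) := by
    intro x y h1 h2
    have h3 : (n : ℤ) % 3 = (x ^ 2 % 3 + 2 * (y ^ 2 % 3)) % 3 := by
      rw [← h1]
      have : (d : ℤ) % 3 = 2 := by omega
      simp [Int.add_emod, Int.mul_emod, this]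
    rw [sq_emod_three, sq_emod_three] at h3
    have h4 : (n : ℤ) % 3 ≠ 0 := by omega
    split_ifs at h3 <;> omega
  have h1 : #{z ∈ reps d n | z.2 = 0} =
      #((Icc (-n : ℤ) n).filter fun x : ℤ => ((1 : ℕ) : ℤ) * x ^ 2 = n ∧ x % 3 = 1) := by
    refine Finset.card_nbij' (fun z => z.1) (fun x => (x, 0)) ?_ ?_ ?_ ?_
    · rintro ⟨x, y⟩ h
      simp only [Finset.coe_filter, Set.mem_ofPred_eq, mem_reps hd0] at h ⊢
      obtain ⟨⟨h, h'⟩, rfl⟩ := h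
      have h2 : ((1 : ℕ) : ℤ) * x ^ 2 = n := by push_cast; linarith
      exact ⟨mem_Icc_of_mul_sq_le one_pos h2.le, h2, by simpa using h'⟩
    · intro x h
      simp only [Finset.coe_filter, Set.mem_ofPred_eq, mem_reps hd0] at h ⊢
      obtain ⟨-, h, h'⟩ := h
      push_cast at h
      exact ⟨⟨by linarith, by simpa using h'⟩, trivial⟩
    · rintro ⟨x, y⟩ h
      simp only [Finset.coe_filter, Set.mem_ofPred_eq] at h ⊢
      rw [h.2]
    · intro x _
      rfl
  have h2 : #{z ∈ {z ∈ reps d n | ¬ z.2 = 0} | z.1 = 0} =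
      #((Icc (-n : ℤ) n).filter fun x : ℤ => (d : ℤ) * x ^ 2 = n ∧ x % 3 = 1) := by
    refine Finset.card_nbij' (fun z => z.2) (fun x => (0, x)) ?_ ?_ ?_ ?_
    · rintro ⟨x, y⟩ h
      simp only [Finset.coe_filter, Finset.mem_filter, Set.mem_ofPred_eq, mem_reps hd0] at h ⊢
      obtain ⟨⟨⟨h, h'⟩, -⟩, rfl⟩ := h
      have h2 : (d : ℤ) * y ^ 2 = n := by linarith
      exact ⟨mem_Icc_of_mul_sq_le hd0 h2.le, h2, by simpa using h'⟩
    · intro x h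
      simp only [Finset.coe_filter, Finset.mem_filter, Set.mem_ofPred_eq, mem_reps hd0] at h ⊢
      obtain ⟨-, h, h'⟩ := h
      refine ⟨⟨⟨by linarith, by simpa using h'⟩, ?_⟩, trivial⟩
      rintro rfl
      omega
    · rintro ⟨x, y⟩ h
      simp only [Finset.coe_filter, Set.mem_ofPred_eq] at h ⊢
      rw [h.2]
    · intro x _
      rfl
  have h3 : (#{z ∈ {z ∈ reps d n | ¬ z.2 = 0} | ¬ z.1 = 0} : ZMod 2) = 0 := by
    refine card_eq_zero_of_involution _
      (fun z => if z.2 % 3 = 0 then (z.1, -z.2) else (-z.1, z.2)) ?_ ?_ ?_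
    · rintro ⟨x, y⟩ h
      simp only [Finset.mem_filter, mem_reps hd0] at h
      obtain ⟨⟨⟨h, h'⟩, hy⟩, hx⟩ := h
      have := hmod x y h h'
      simp only
      split_ifs with h0
      · simp only [Finset.mem_filter, mem_reps hd0]
        refine ⟨⟨⟨by linarith [neg_sq y], by omega⟩, by omega⟩, hx⟩
      · simp only [Finset.mem_filter, mem_reps hd0]
        refine ⟨⟨⟨by linarith [neg_sq x], by omega⟩, hy⟩, by omega⟩
    · rintro ⟨x, y⟩ h
      simp only [Finset.mem_filter] at h
      simp only
      split_ifs
      · intro h1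
        have := congrArg Prod.snd h1
        simp only at this
        omega
      · intro h1
        have := congrArg Prod.fst h1
        simp only at this
        omega
    · rintro ⟨x, y⟩ h
      by_cases h0 : y % 3 = 0
      · have h1 : -y % 3 = 0 := by omega
        simp [h0, h1]
      · simp [h0]
  rw [← Finset.card_filter_add_card_filter_not (s := reps d n) (fun z => z.2 = 0),
    ← Finset.card_filter_add_card_filter_not (s := {z ∈ reps d n | ¬ z.2 = 0}) (fun z => z.1 = 0),
    h1, h2, Nat.cast_add, Nat.cast_add, h3, card_filter_mul_sq 1 n one_pos hn,
    card_filter_mul_sq d n hd0 hn]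
  simp

/-- Multiplication by −(1 + √−2), of norm 3. The normalisation forces x ≡ y ≡ 2 mod 3 on the larger
side, so division by this element, rather than its conjugate, is always possible. -/
theorem card_reps_two_mul (m : ℕ) : #(reps 2 (3 * m)) = #(reps 2 m) := by
  refine Finset.card_nbij' (fun z => (-((z.1 + 2 * z.2) / 3), -((z.2 - z.1) / 3)))
    (fun z => (-(z.1 - 2 * z.2), -(z.1 + z.2))) ?_ ?_ ?_ ?_
  · rintro ⟨x, y⟩ h
    simp only [Finset.mem_coe, mem_reps two_pos] at h ⊢
    obtain ⟨h, h'⟩ := h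
    push_cast at h ⊢
    have h3 : (x ^ 2 % 3 + 2 * (y ^ 2 % 3)) % 3 = 0 := by omega
    rw [sq_emod_three, sq_emod_three] at h3
    have h4 : x % 3 = 2 ∧ y % 3 = 2 := by split_ifs at h3 <;> omega
    obtain ⟨k, hk⟩ : ∃ k, x = y - 3 * k := ⟨(y - x) / 3, by omega⟩
    subst hk
    have e1 : (y - 3 * k + 2 * y) / 3 = y - k := by omega
    have e2 : (y - (y - 3 * k)) / 3 = k := by omega
    rw [e1, e2]
    exact ⟨by nlinarith, by omega⟩
  · rintro ⟨x, y⟩ h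
    simp only [Finset.mem_coe, mem_reps two_pos] at h ⊢
    obtain ⟨h, h'⟩ := h
    push_cast at h ⊢
    exact ⟨by rw [← h]; ring, by omega⟩
  · rintro ⟨x, y⟩ h
    simp only [Finset.mem_coe, mem_reps two_pos] at h ⊢
    obtain ⟨h, h'⟩ := h
    push_cast at h
    have h3 : (x ^ 2 % 3 + 2 * (y ^ 2 % 3)) % 3 = 0 := by omega
    rw [sq_emod_three, sq_emod_three] at h3
    have h4 : x % 3 = 2 ∧ y % 3 = 2 := by split_ifs at h3 <;> omega
    ext <;> simp only <;> omega
  · rintro ⟨x, y⟩ h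
    ext <;> simp only <;> omega

open Classical in
theorem card_reps_two (n : ℕ) (hn : n % 2 = 1) :
    (#(reps 2 n) : ZMod 2) =
      (if ∃ k : ℕ, n = k ^ 2 then 1 else 0) + if ∃ k : ℕ, n = 3 * k ^ 2 then 1 else 0 := by
  induction n using Nat.strong_induction_on with
  | _ n ih =>
    by_cases h3 : 3 ∣ n
    · obtain ⟨m, rfl⟩ := h3
      rw [card_reps_two_mul, ih m (by omega) (by omega), add_comm]
      have e1 : (∃ k : ℕ, 3 * m = k ^ 2) ↔ ∃ k : ℕ, m = 3 * k ^ 2 := by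
        constructor
        · rintro ⟨k, hk⟩
          obtain ⟨c, rfl⟩ : 3 ∣ k := Nat.prime_three.dvd_of_dvd_pow ⟨m, hk.symm⟩
          exact ⟨c, by nlinarith⟩
        · rintro ⟨k, rfl⟩
          exact ⟨3 * k, by ring⟩
      have e2 : (∃ k : ℕ, 3 * m = 3 * k ^ 2) ↔ ∃ k : ℕ, m = k ^ 2 := by
        refine exists_congr fun k => ?_
        omega
      simp only [e1, e2]
    · rw [card_reps_of_not_dvd 2 n rfl h3]
      congr 1
      rw [if_neg, if_neg]
      · rintro ⟨k, rfl⟩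
        exact h3 (dvd_mul_right _ _)
      · rintro ⟨k, rfl⟩
        omega

/-- Multiplication by 2 − √−5, of norm 9. The normalisation forces x ≡ −2y mod 9, which makes the
division exact. -/
theorem card_reps_five_nine_mul (m : ℕ) : #(reps 5 (9 * m)) = #(reps 5 m) := by
  have key : ∀ x y : ℤ, x ^ 2 + 5 * y ^ 2 = 9 * m → (x + y) % 3 = 1 →
      ∃ k, x = 9 * k - 2 * y := by
    intro x y h h'
    have h3 : (x ^ 2 % 3 + 2 * (y ^ 2 % 3)) % 3 = 0 := by omega
    rw [sq_emod_three, sq_emod_three] at h3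
    have h4 : x % 3 = 2 ∧ y % 3 = 2 := by split_ifs at h3 <;> omega
    obtain ⟨k, hk⟩ : ∃ k, x = y + 3 * k := ⟨(x - y) / 3, by omega⟩
    have h5 : 2 * (y * (y + k)) = 3 * (m - k ^ 2) := by subst hk; nlinarith
    have h6 : (3 : ℤ) ∣ y * (y + k) := by omega
    rcases Int.prime_three.dvd_or_dvd h6 with h7 | h7
    · omega
    · exact ⟨(x + 2 * y) / 9, by omega⟩
  refine Finset.card_nbij' (fun z => ((2 * z.1 - 5 * z.2) / 9, (z.1 + 2 * z.2) / 9))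
    (fun z => (2 * z.1 + 5 * z.2, 2 * z.2 - z.1)) ?_ ?_ ?_ ?_
  · rintro ⟨x, y⟩ h
    simp only [Finset.mem_coe, mem_reps (show 0 < 5 by norm_num)] at h ⊢
    obtain ⟨h, h'⟩ := h
    push_cast at h ⊢
    obtain ⟨k, rfl⟩ := key x y h h'
    have e1 : (2 * (9 * k - 2 * y) - 5 * y) / 9 = 2 * k - y := by omega
    have e2 : (9 * k - 2 * y + 2 * y) / 9 = k := by omega
    rw [e1, e2]
    exact ⟨by nlinarith, by omega⟩
  · rintro ⟨x, y⟩ h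
    simp only [Finset.mem_coe, mem_reps (show 0 < 5 by norm_num)] at h ⊢
    obtain ⟨h, h'⟩ := h
    push_cast at h ⊢
    exact ⟨by rw [← h]; ring, by omega⟩
  · rintro ⟨x, y⟩ h
    simp only [Finset.mem_coe, mem_reps (show 0 < 5 by norm_num)] at h
    obtain ⟨k, rfl⟩ := key x y (by simpa using h.1) h.2
    ext <;> simp only <;> omega
  · rintro ⟨x, y⟩ h
    ext <;> simp only <;> omega

/-- Setting x = y + 3k turns the equation into m = 2y² + 2yk + 3k², the other form of discriminant
−20. Its automorphisms (y, k) ↦ (y + k, −k), used when 3 ∣ k, and (y, k) ↦ (−y − k, k), used when k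
≡ 2 mod 3, give the involution; k ≡ 1 would force 3 ∣ m. A fixed point would make m equal to 2y² or
10y², which is even. -/
theorem card_reps_five_three_mul (m : ℕ) (hm : m % 2 = 1) (h3 : ¬ 3 ∣ m) :
    (#(reps 5 (3 * m)) : ZMod 2) = 0 := by
  have key : ∀ x y : ℤ, (x, y) ∈ reps 5 (3 * m) →
      ∃ k, x = y + 3 * k ∧ y % 3 = 2 ∧ k % 3 ≠ 1 ∧ 3 * k ^ 2 + 2 * y * k + 2 * y ^ 2 = m := by
    intro x y h
    rw [mem_reps (show 0 < 5 by norm_num)] at h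
    obtain ⟨h, h'⟩ := h
    push_cast at h
    have h3 : (x ^ 2 % 3 + 2 * (y ^ 2 % 3)) % 3 = 0 := by omega
    rw [sq_emod_three, sq_emod_three] at h3
    have h4 : x % 3 = 2 ∧ y % 3 = 2 := by split_ifs at h3 <;> omega
    obtain ⟨k, hk⟩ : ∃ k, x = y + 3 * k := ⟨(x - y) / 3, by omega⟩
    have h5 : 3 * k ^ 2 + 2 * y * k + 2 * y ^ 2 = m := by subst hk; nlinarith
    refine ⟨k, hk, h4.2, fun hk1 => ?_, h5⟩
    obtain ⟨c, hc⟩ : (3 : ℤ) ∣ y + k := by omega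
    have h6 : (m : ℤ) = 3 * (k ^ 2 + 2 * y * c) := by
      rw [← h5]
      linear_combination 2 * y * hc
    omega
  refine card_eq_zero_of_involution _ (fun z =>
    if ((z.1 - z.2) / 3) % 3 = 0 then
      (-(2 * ((z.1 - z.2) / 3) - z.2), z.2 + (z.1 - z.2) / 3)
    else (2 * ((z.1 - z.2) / 3) - z.2, -(z.2 + (z.1 - z.2) / 3))) ?_ ?_ ?_
  · rintro ⟨x, y⟩ h
    obtain ⟨k, rfl, hy, hk, h5⟩ := key x y h
    have e : (y + 3 * k - y) / 3 = k := by omega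
    simp only [e]
    split_ifs
    · rw [mem_reps (show 0 < 5 by norm_num)]
      push_cast
      exact ⟨by linear_combination 3 * h5, by omega⟩
    · rw [mem_reps (show 0 < 5 by norm_num)]
      push_cast
      exact ⟨by linear_combination 3 * h5, by omega⟩
  · rintro ⟨x, y⟩ h
    obtain ⟨k, rfl, hy, hk, h5⟩ := key x y h
    have e : (y + 3 * k - y) / 3 = k := by omega
    simp only [e]
    split_ifs
    · intro h1
      rw [Prod.mk.injEq] at h1
      obtain rfl : k = 0 := by omega
      obtain ⟨c, hc⟩ : ∃ c, c = y ^ 2 := ⟨_, rfl⟩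
      have : 2 * c = m := by rw [hc]; linarith
      omega
    · intro h1
      rw [Prod.mk.injEq] at h1
      obtain rfl : k = -2 * y := by omega
      obtain ⟨c, hc⟩ : ∃ c, c = y ^ 2 := ⟨_, rfl⟩
      have : 10 * c = m := by rw [hc]; linarith
      omega
  · rintro ⟨x, y⟩ h
    obtain ⟨k, rfl, hy, hk, h5⟩ := key x y h
    have e : (y + 3 * k - y) / 3 = k := by omega
    simp only [e]
    split_ifs with h1 h2 h2
    · simp only at h2
      ext <;> simp only <;> omega
    · simp only at h2
      omega
    · simp only at h2
      omega
    · simp only at h2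
      ext <;> simp only <;> omega

open Classical in
theorem card_reps_five (n : ℕ) (hn : n % 2 = 1) :
    (#(reps 5 n) : ZMod 2) =
      (if ∃ k : ℕ, n = k ^ 2 then 1 else 0) + if ∃ k : ℕ, n = 5 * k ^ 2 then 1 else 0 := by
  induction n using Nat.strong_induction_on with
  | _ n ih =>
    have hsq : ∀ k : ℕ, 3 ∣ k ^ 2 → ∃ c, k = 3 * c := fun k hk =>
      Nat.prime_three.dvd_of_dvd_pow hk
    by_cases h3 : 3 ∣ n
    · by_cases h9 : 9 ∣ n
      · obtain ⟨m, rfl⟩ := h9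
        rw [card_reps_five_nine_mul, ih m (by omega) (by omega)]
        have e1 : (∃ k : ℕ, 9 * m = k ^ 2) ↔ ∃ k : ℕ, m = k ^ 2 := by
          constructor
          · rintro ⟨k, hk⟩
            obtain ⟨c, rfl⟩ := hsq k (by omega)
            exact ⟨c, by nlinarith⟩
          · rintro ⟨k, rfl⟩
            exact ⟨3 * k, by ring⟩
        have e2 : (∃ k : ℕ, 9 * m = 5 * k ^ 2) ↔ ∃ k : ℕ, m = 5 * k ^ 2 := by
          constructor
          · rintro ⟨k, hk⟩
            obtain ⟨c, rfl⟩ := hsq k (by omega)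
            exact ⟨c, by nlinarith⟩
          · rintro ⟨k, rfl⟩
            exact ⟨3 * k, by ring⟩
        simp only [e1, e2]
      · obtain ⟨m, rfl⟩ := h3
        rw [card_reps_five_three_mul m (by omega) (by omega), if_neg, if_neg, add_zero]
        · rintro ⟨k, hk⟩
          obtain ⟨c, rfl⟩ := hsq k (by omega)
          exact h9 ⟨5 * c ^ 2, by rw [hk]; ring⟩
        · rintro ⟨k, hk⟩
          obtain ⟨c, rfl⟩ := hsq k (by omega)
          exact h9 ⟨c ^ 2, by rw [hk]; ring⟩
    · exact card_reps_of_not_dvd 5 n rfl h3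

end ModTwo

/-! ### Theta series and the modular equation of degree 5. -/

namespace ModTwo

open PowerSeries

open Finset in
/-- The series `∑ q^{c x²}` over the integers `x ≡ 1` modulo 6. -/
noncomputable def thetaSix (c : ℕ) : PowerSeries (ZMod 2) :=
  PowerSeries.mk fun n =>
    (#((Icc (-n : ℤ) n).filter fun x : ℤ => c * x ^ 2 = n ∧ x % 6 = 1) : ZMod 2)

open Finset in
/-- The representations `n = x² + d y²` with `x` and `y` congruent to 1 modulo 6. -/
noncomputable def repsSix (d n : ℕ) : Finset (ℤ × ℤ) :=
  {z ∈ Icc (-n : ℤ) n ×ˢ Icc (-n : ℤ) n |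
    z.1 ^ 2 + d * z.2 ^ 2 = n ∧ z.1 % 6 = 1 ∧ z.2 % 6 = 1}

theorem mem_repsSix {d n : ℕ} (hd : 0 < d) {x y : ℤ} :
    (x, y) ∈ repsSix d n ↔ x ^ 2 + d * y ^ 2 = n ∧ x % 6 = 1 ∧ y % 6 = 1 := by
  simp only [repsSix, Finset.mem_filter, Finset.mem_product, and_iff_right_iff_imp]
  rintro ⟨h, -⟩
  have hd' : (1 : ℤ) ≤ d := by exact_mod_cast hd
  refine ⟨mem_Icc_of_mul_sq_le one_pos ?_, mem_Icc_of_mul_sq_le hd ?_⟩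
  · push_cast; nlinarith [sq_nonneg y]
  · nlinarith [sq_nonneg x]

open Finset in
theorem coeff_thetaSix_mul (d n : ℕ) (hd : 0 < d) :
    coeff n (thetaSix 1 * thetaSix d) = (#(repsSix d n) : ZMod 2) := by
  rw [coeff_mul]
  simp only [thetaSix, coeff_mk]
  simp_rw [← Nat.cast_mul, ← Finset.card_product]
  rw [← Nat.cast_sum, ← Finset.card_sigma]
  congr 1
  refine Finset.card_nbij' (fun z => z.2)
    (fun z => ⟨((z.1 ^ 2).toNat, (d * z.2 ^ 2).toNat), z⟩) ?_ ?_ ?_ ?_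
  · rintro ⟨⟨a, b⟩, ⟨x, y⟩⟩ h
    simp only [Finset.mem_coe, Finset.mem_sigma, Finset.mem_product, Finset.mem_filter,
      Finset.HasAntidiagonal.mem_antidiagonal, mem_repsSix hd] at h ⊢
    obtain ⟨rfl, ⟨-, h1, h2⟩, -, h3, h4⟩ := h
    push_cast at h1 ⊢
    exact ⟨by linarith, h2, h4⟩
  · rintro ⟨x, y⟩ h
    simp only [Finset.mem_coe, Finset.mem_sigma, Finset.mem_product, Finset.mem_filter,
      Finset.HasAntidiagonal.mem_antidiagonal, mem_repsSix hd] at h ⊢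
    obtain ⟨h, hx, hy⟩ := h
    have e1 : ((x ^ 2).toNat : ℤ) = x ^ 2 := Int.toNat_of_nonneg (by positivity)
    have e2 : ((d * y ^ 2).toNat : ℤ) = d * y ^ 2 := Int.toNat_of_nonneg (by positivity)
    refine ⟨by zify; rw [e1, e2, h], ⟨mem_Icc_of_mul_sq_le one_pos ?_, ?_, hx⟩,
      mem_Icc_of_mul_sq_le hd ?_, ?_, hy⟩ <;> simp [e1, e2]
  · rintro ⟨⟨a, b⟩, ⟨x, y⟩⟩ h
    simp only [Finset.mem_coe, Finset.mem_sigma, Finset.mem_product, Finset.mem_filter] at h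
    obtain ⟨-, ⟨-, h1, -⟩, -, h3, -⟩ := h
    have e1 : (x ^ 2).toNat = a := by push_cast at h1; omega
    have e2 : (d * y ^ 2).toNat = b := by omega
    simp only [e1, e2]
  · intro z _
    rfl

theorem sq_emod_of_emod_six {x : ℤ} (h : x % 6 = 1) : x ^ 2 % 24 = 1 := by
  have : x % 24 = 1 ∨ x % 24 = 7 ∨ x % 24 = 13 ∨ x % 24 = 19 := by omega
  rcases this with h | h | h | h <;> simp [pow_two, Int.mul_emod, h]

theorem sq_emod_eight (x : ℤ) : (x % 2 = 1 ∧ x ^ 2 % 8 = 1) ∨ (x % 2 = 0 ∧ x ^ 2 % 4 = 0) := by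
  rcases Int.emod_two_eq_zero_or_one x with h0 | h0
  · right
    refine ⟨h0, ?_⟩
    have : x % 4 = 0 ∨ x % 4 = 2 := by omega
    rcases this with h | h <;> simp [pow_two, Int.mul_emod, h]
  · left
    refine ⟨h0, ?_⟩
    have : x % 8 = 1 ∨ x % 8 = 3 ∨ x % 8 = 5 ∨ x % 8 = 7 := by omega
    rcases this with h | h | h | h <;> simp [pow_two, Int.mul_emod, h]

open Finset in
-- When n ≡ 3 mod 24, solutions in `reps` have x ≡ y ≡ 2 mod 3 and, by squares mod 8, both
-- coordinates odd; negation then matches the two sets.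
theorem card_repsSix_two (n : ℕ) :
    #(repsSix 2 n) = if n % 24 = 3 then #(reps 2 n) else 0 := by
  split_ifs with hn
  · refine Finset.card_nbij' (fun z => -z) (fun z => -z) ?_ ?_
      (fun z _ => neg_neg z) (fun z _ => neg_neg z)
    · rintro ⟨x, y⟩ h
      simp only [Finset.mem_coe, mem_repsSix two_pos, Prod.neg_mk, mem_reps two_pos] at h ⊢
      obtain ⟨h, hx, hy⟩ := h
      exact ⟨by linarith [neg_sq x, neg_sq y], by omega⟩
    · rintro ⟨x, y⟩ h
      simp only [Finset.mem_coe, mem_repsSix two_pos, Prod.neg_mk, mem_reps two_pos] at h ⊢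
      obtain ⟨h, h'⟩ := h
      push_cast at h
      have h3 : (x ^ 2 % 3 + 2 * (y ^ 2 % 3)) % 3 = 0 := by omega
      rw [sq_emod_three, sq_emod_three] at h3
      have h4 : x % 3 = 2 ∧ y % 3 = 2 := by split_ifs at h3 <;> omega
      have h5 : x % 2 = 1 ∧ y % 2 = 1 := by
        rcases sq_emod_eight x with hx | hx <;> rcases sq_emod_eight y with hy | hy <;> omega
      push_cast
      exact ⟨by linarith [neg_sq x, neg_sq y], by omega, by omega⟩
  · rw [Finset.card_eq_zero, Finset.eq_empty_iff_forall_notMem]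
    rintro ⟨x, y⟩ h
    rw [mem_repsSix two_pos] at h
    obtain ⟨h, hx, hy⟩ := h
    have := sq_emod_of_emod_six hx
    have := sq_emod_of_emod_six hy
    push_cast at h
    omega

open Finset in
-- Division by 1 + √−5, of norm 6.
theorem card_repsSix_five (n : ℕ) :
    #(repsSix 5 n) = if n % 24 = 6 then #(reps 5 (n / 6)) else 0 := by
  have h5 : 0 < 5 := by norm_num
  split_ifs with hn
  · obtain ⟨m, rfl⟩ : ∃ m, n = 6 * m := ⟨n / 6, by omega⟩
    rw [Nat.mul_div_cancel_left _ (by norm_num)]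
    refine Finset.card_nbij' (fun z => ((z.1 + 5 * z.2) / 6, (z.2 - z.1) / 6))
      (fun z => (z.1 - 5 * z.2, z.1 + z.2)) ?_ ?_ ?_ ?_
    · rintro ⟨x, y⟩ h
      simp only [Finset.mem_coe, mem_repsSix h5, mem_reps h5] at h ⊢
      obtain ⟨h, hx, hy⟩ := h
      obtain ⟨k, rfl⟩ : ∃ k, x = y - 6 * k := ⟨(y - x) / 6, by omega⟩
      have e1 : (y - 6 * k + 5 * y) / 6 = y - k := by omega
      have e2 : (y - (y - 6 * k)) / 6 = k := by omega
      rw [e1, e2]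
      push_cast at h ⊢
      exact ⟨by nlinarith, by omega⟩
    · rintro ⟨x, y⟩ h
      simp only [Finset.mem_coe, mem_repsSix h5, mem_reps h5] at h ⊢
      obtain ⟨h, h'⟩ := h
      push_cast at h ⊢
      have h6 : (x + y) % 2 = 1 := by
        rcases sq_emod_eight x with hx | hx <;> rcases sq_emod_eight y with hy | hy <;> omega
      exact ⟨by rw [← h]; ring, by omega, by omega⟩
    · rintro ⟨x, y⟩ h
      simp only [Finset.mem_coe, mem_repsSix h5] at h
      ext <;> simp only <;> omega
    · rintro ⟨x, y⟩ h
      ext <;> simp only <;> omega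
  · rw [Finset.card_eq_zero, Finset.eq_empty_iff_forall_notMem]
    rintro ⟨x, y⟩ h
    rw [mem_repsSix h5] at h
    obtain ⟨h, hx, hy⟩ := h
    have := sq_emod_of_emod_six hx
    have := sq_emod_of_emod_six hy
    push_cast at h
    omega

theorem sq_eq_expand (f : PowerSeries (ZMod 2)) : f ^ 2 = expand 2 two_ne_zero f := by
  have h := MvPowerSeries.map_frobenius_expand (σ := Unit) (p := 2) two_ne_zero (f := f)
  rw [ZMod.frobenius_zmod, MvPowerSeries.map_id] at h
  exact h.symm

theorem expand_thetaSix (p : ℕ) (hp : p ≠ 0) : expand p hp (thetaSix 1) = thetaSix p := by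
  ext n
  rw [coeff_expand]
  simp only [thetaSix, coeff_mk]
  have hp' : (p : ℤ) ≠ 0 := by exact_mod_cast hp
  split_ifs with h
  · obtain ⟨m, rfl⟩ := h
    rw [Nat.mul_div_cancel_left _ (Nat.pos_of_ne_zero hp)]
    congr 2
    ext x
    simp only [Finset.mem_filter]
    push_cast
    rw [one_mul, mul_right_inj' hp']
    refine ⟨fun h => ⟨?_, h.2⟩, fun h => ⟨?_, h.2⟩⟩
    · have := mem_Icc_of_mul_sq_le (d := p) (n := p * m) (Nat.pos_of_ne_zero hp) (x := x)
        (by push_cast; rw [h.2.1])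
      simpa using this
    · exact mem_Icc_of_mul_sq_le (d := 1) one_pos (by push_cast; rw [h.2.1, one_mul])
  · symm
    rw [Finset.filter_false_of_mem, Finset.card_empty, Nat.cast_zero]
    rintro x - ⟨hx, -⟩
    exact h (by exact_mod_cast Dvd.intro _ hx)

theorem odd_sq_mod_eight (m : ℕ) : (2 * m + 1) ^ 2 % 8 = 1 := by
  have := sq_emod_eight (2 * m + 1)
  zify
  omega

theorem exists_odd_sq_iff {n : ℕ} (hn : n % 2 = 1) :
    (∃ m : ℕ, n = (2 * m + 1) ^ 2) ↔ ∃ k : ℕ, n = k ^ 2 := by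
  refine ⟨fun ⟨m, hm⟩ => ⟨_, hm⟩, fun ⟨k, hk⟩ => ?_⟩
  have hk2 : k % 2 = 1 := by
    by_contra h
    have : 2 ∣ k := by omega
    have := dvd_pow this two_ne_zero
    omega
  exact ⟨k / 2, by rw [hk]; congr 1; omega⟩

theorem not_exists_odd_sq {n : ℕ} (hn : n % 8 ≠ 1) : ¬ ∃ m : ℕ, n = (2 * m + 1) ^ 2 := by
  rintro ⟨m, rfl⟩
  exact hn (odd_sq_mod_eight m)

theorem thetaSix_cube : thetaSix 1 ^ 3 = expand 3 three_ne_zero Delta := by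
  classical
  rw [pow_succ', sq_eq_expand, expand_thetaSix]
  ext n
  rw [coeff_thetaSix_mul 2 n two_pos, card_repsSix_two, coeff_expand]
  simp only [Delta, coeff_mk]
  by_cases h3 : 3 ∣ n
  · obtain ⟨m, rfl⟩ := h3
    rw [if_pos (dvd_mul_right _ _), Nat.mul_div_cancel_left _ (by norm_num)]
    by_cases hm : m % 8 = 1
    -- Here 3m ≡ 3 mod 8 is not a square, so only the indicator of 3m = 3k² survives.
    · rw [if_pos (by omega), card_reps_two _ (by omega), if_neg, zero_add]
      · simp only [mul_right_inj' three_ne_zero, exists_odd_sq_iff (show m % 2 = 1 by omega)]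
      · rw [← exists_odd_sq_iff (by omega)]
        exact not_exists_odd_sq (by omega)
    · rw [if_neg (by omega), if_neg (not_exists_odd_sq hm), Nat.cast_zero]
  · rw [if_neg h3, if_neg (by omega), Nat.cast_zero]

theorem thetaSix_mul_thetaSix_five :
    thetaSix 1 * thetaSix 5 =
      expand 6 (by norm_num) Delta + expand 30 (by norm_num) Delta := by
  classical
  ext n
  rw [coeff_thetaSix_mul 5 n (by norm_num), card_repsSix_five, map_add, coeff_expand, coeff_expand]
  simp only [Delta, coeff_mk]
  by_cases h6 : 6 ∣ n
  · obtain ⟨m, rfl⟩ := h6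
    have e5 : (30 ∣ 6 * m) ↔ 5 ∣ m := by omega
    have e30 : 6 * m / 30 = m / 5 := by omega
    rw [if_pos (dvd_mul_right _ _), Nat.mul_div_cancel_left _ (by norm_num), e30]
    simp only [e5]
    by_cases hm : m % 4 = 1
    · rw [if_pos (by omega), card_reps_five _ (by omega)]
      simp only [exists_odd_sq_iff (show m % 2 = 1 by omega)]
      congr 1
      by_cases h5 : 5 ∣ m
      · obtain ⟨c, rfl⟩ := h5
        rw [if_pos (dvd_mul_right _ _), Nat.mul_div_cancel_left _ (by norm_num)]
        simp only [mul_right_inj' (show (5 : ℕ) ≠ 0 by norm_num),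
          exists_odd_sq_iff (show c % 2 = 1 by omega)]
      · rw [if_neg h5, if_neg]
        rintro ⟨k, rfl⟩
        exact h5 (dvd_mul_right _ _)
    · rw [if_neg (by omega), if_neg (not_exists_odd_sq (by omega)), Nat.cast_zero, zero_add]
      split_ifs with h5 h7
      · exact absurd h7 (not_exists_odd_sq (by omega))
      · rfl
      · rfl
  · rw [if_neg h6, if_neg (by omega), if_neg (by omega), Nat.cast_zero, add_zero]

theorem five_ne_zero : (5 : ℕ) ≠ 0 := by norm_num

theorem expand_injective (p : ℕ) (hp : p ≠ 0) :
    Function.Injective (expand p hp : PowerSeries (ZMod 2) →ₐ[ZMod 2] _) := by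
  intro f g hfg
  ext n
  rw [← coeff_expand_mul p hp f, ← coeff_expand_mul p hp g, hfg]

/-- The degree 5 modular equation between `Δ(q)` and `Δ(q⁵)`. -/
theorem modular_equation :
    (Delta + expand 5 five_ne_zero Delta) ^ 6 = Delta * expand 5 five_ne_zero Delta := by
  -- After q ↦ q³ both sides become (θ(q)θ(q⁵))³.
  apply expand_injective 3 three_ne_zero
  have h5 : thetaSix 5 ^ 3 = expand 3 three_ne_zero (expand 5 five_ne_zero Delta) := by
    rw [← expand_thetaSix 5 five_ne_zero, ← map_pow, thetaSix_cube, ← expand_mul, ← expand_mul]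
  have h6 : thetaSix 1 * thetaSix 5 =
      expand 3 three_ne_zero (Delta + expand 5 five_ne_zero Delta) ^ 2 := by
    rw [thetaSix_mul_thetaSix_five, sq_eq_expand, map_add, map_add, ← expand_mul, ← expand_mul,
      ← expand_mul]
  rw [map_mul, ← h5, ← thetaSix_cube, ← mul_pow, h6, map_pow, ← pow_mul]

end ModTwo

/-! ### Recursions for T₅ on powers of Δ. -/

namespace ModTwo

open PowerSeries

/-- The operator `∑ c(n) q^n ↦ ∑ c(5n) q^n`. -/
noncomputable def dissect : PowerSeries (ZMod 2) →ₗ[ZMod 2] PowerSeries (ZMod 2) where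
  toFun f := PowerSeries.mk fun n => coeff (5 * n) f
  map_add' f g := by ext n; simp
  map_smul' c f := by ext n; simp

theorem coeff_dissect (f : PowerSeries (ZMod 2)) (n : ℕ) :
    coeff n (dissect f) = coeff (5 * n) f := by
  simp [dissect]

theorem hecke_five_eq (f : PowerSeries (ZMod 2)) :
    hecke 5 f = dissect f + expand 5 five_ne_zero f := by
  ext n
  rw [map_add, coeff_dissect, coeff_expand]
  simp only [hecke, coeff_mk]
  split_ifs <;> simp

/-- Linearity of U₅ over series in q⁵, which turns relations between Δ and A into recursions. -/
theorem dissect_expand_mul (g f : PowerSeries (ZMod 2)) :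
    dissect (expand 5 five_ne_zero g * f) = g * dissect f := by
  ext n
  rw [coeff_dissect, coeff_mul, coeff_mul]
  symm
  refine Finset.sum_of_injOn (fun z => (5 * z.1, 5 * z.2)) ?_ ?_ ?_ ?_
  · rintro ⟨a, b⟩ _ ⟨c, d⟩ _ h
    simp only [Prod.mk.injEq] at h ⊢
    omega
  · rintro ⟨a, b⟩ h
    simp only [Finset.mem_coe, Finset.HasAntidiagonal.mem_antidiagonal] at h ⊢
    omega
  · rintro ⟨a, b⟩ h h'
    simp only [Finset.HasAntidiagonal.mem_antidiagonal] at h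
    rw [coeff_expand_of_not_dvd, zero_mul]
    rintro ⟨c, rfl⟩
    refine h' ⟨(c, n - c), ?_, ?_⟩
    · simp only [Finset.mem_coe, Finset.HasAntidiagonal.mem_antidiagonal]
      omega
    · simp only [Prod.mk.injEq, true_and]
      omega
  · rintro ⟨a, b⟩ _
    simp only [coeff_expand_mul, coeff_dissect]

theorem dissect_sq (f : PowerSeries (ZMod 2)) : dissect (f ^ 2) = dissect f ^ 2 := by
  ext n
  rw [sq_eq_expand, sq_eq_expand, coeff_dissect, coeff_expand, coeff_expand, coeff_dissect]
  by_cases h : 2 ∣ n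
  · obtain ⟨m, rfl⟩ := h
    rw [if_pos ⟨5 * m, by ring⟩, if_pos (dvd_mul_right _ _)]
    congr 2
    omega
  · rw [if_neg h, if_neg (by omega)]

theorem charTwo : (2 : PowerSeries (ZMod 2)) = 0 := by
  have : ((2 : ZMod 2)) = 0 := by decide
  rw [← map_ofNat (C : ZMod 2 →+* PowerSeries (ZMod 2)) 2, this, map_zero]

theorem add_sq_eq (f g : PowerSeries (ZMod 2)) : (f + g) ^ 2 = f ^ 2 + g ^ 2 := by
  linear_combination f * g * charTwo

/-- The image of `Δ^k` under `T₅`. -/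
noncomputable def heckePow (k : ℕ) : PowerSeries (ZMod 2) := hecke 5 (Delta ^ k)

theorem heckePow_eq (k : ℕ) :
    heckePow k = dissect (Delta ^ k) + expand 5 five_ne_zero Delta ^ k := by
  rw [heckePow, hecke_five_eq, map_pow (expand 5 five_ne_zero)]

theorem heckePow_two_mul (k : ℕ) : heckePow (2 * k) = heckePow k ^ 2 := by
  rw [heckePow_eq, heckePow_eq, mul_comm, pow_mul, pow_mul, dissect_sq, add_sq_eq]

theorem dissect_expand_pow_mul (i : ℕ) (g f : PowerSeries (ZMod 2)) :
    dissect (expand 5 five_ne_zero g ^ i * f) = g ^ i * dissect f := by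
  rw [← map_pow, dissect_expand_mul]

/-- Modulo 2 the modular equation reads Δ⁶ = A²Δ⁴ + A⁴Δ² + AΔ + A⁶. Multiplying by Δ^k and applying
U₅ treats one half of T₅; by symmetry in Δ and A, multiplying by A^k treats the other. -/
theorem heckePow_add_six (k : ℕ) :
    heckePow (k + 6) = Delta ^ 2 * heckePow (k + 4) + Delta ^ 4 * heckePow (k + 2) +
      Delta * heckePow (k + 1) + Delta ^ 6 * heckePow k := by
  simp only [heckePow_eq]
  have hm := modular_equation
  set A := expand 5 five_ne_zero Delta with hA
  have h1 : Delta ^ (k + 6) = A ^ 2 * Delta ^ (k + 4) + A ^ 4 * Delta ^ (k + 2) +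
      A ^ 1 * Delta ^ (k + 1) + A ^ 6 * Delta ^ k := by
    linear_combination Delta ^ k * hm - Delta ^ k * (3 * Delta ^ 5 * A + 8 * Delta ^ 4 * A ^ 2 +
      10 * Delta ^ 3 * A ^ 3 + 8 * Delta ^ 2 * A ^ 4 + 3 * Delta * A ^ 5 + A ^ 6) * charTwo
  have h2 : dissect (Delta ^ (k + 6)) = Delta ^ 2 * dissect (Delta ^ (k + 4)) +
      Delta ^ 4 * dissect (Delta ^ (k + 2)) + Delta ^ 1 * dissect (Delta ^ (k + 1)) +
      Delta ^ 6 * dissect (Delta ^ k) := by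
    rw [h1]
    simp only [map_add, hA, dissect_expand_pow_mul]
  linear_combination h2 + A ^ k * hm - A ^ k * (3 * Delta ^ 5 * A + 8 * Delta ^ 4 * A ^ 2 +
      10 * Delta ^ 3 * A ^ 3 + 8 * Delta ^ 2 * A ^ 4 + 3 * Delta * A ^ 5 + Delta ^ 6) * charTwo

/-- The modular equation read as AΔ = ((Δ + A)³)², with (Δ + A)³ = Δ³ + AΔ² + A²Δ + A³ modulo 2. -/
theorem Delta_mul_heckePow (j : ℕ) :
    Delta * heckePow (2 * j + 1) = (heckePow (j + 3) + Delta * heckePow (j + 2) +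
      Delta ^ 2 * heckePow (j + 1) + Delta ^ 3 * heckePow j) ^ 2 := by
  simp only [heckePow_eq]
  have hm := modular_equation
  set A := expand 5 five_ne_zero Delta with hA
  have h1 : A ^ 1 * Delta ^ (2 * j + 1) = (A ^ 0 * Delta ^ (j + 3) + A ^ 1 * Delta ^ (j + 2) +
      A ^ 2 * Delta ^ (j + 1) + A ^ 3 * Delta ^ j) ^ 2 := by
    linear_combination (-Delta ^ (2 * j)) * hm + Delta ^ (2 * j) * (2 * Delta ^ 5 * A +
      6 * Delta ^ 4 * A ^ 2 + 8 * Delta ^ 3 * A ^ 3 + 6 * Delta ^ 2 * A ^ 4 +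
      2 * Delta * A ^ 5) * charTwo
  have h2 : Delta ^ 1 * dissect (Delta ^ (2 * j + 1)) = (Delta ^ 0 * dissect (Delta ^ (j + 3)) +
      Delta ^ 1 * dissect (Delta ^ (j + 2)) + Delta ^ 2 * dissect (Delta ^ (j + 1)) +
      Delta ^ 3 * dissect (Delta ^ j)) ^ 2 := by
    rw [← dissect_expand_pow_mul, ← hA, h1, dissect_sq]
    simp only [map_add, hA, dissect_expand_pow_mul]
  have h3 : Delta * A ^ (2 * j + 1) = (A ^ (j + 3) + Delta * A ^ (j + 2) +
      Delta ^ 2 * A ^ (j + 1) + Delta ^ 3 * A ^ j) ^ 2 := by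
    linear_combination (-A ^ (2 * j)) * hm + A ^ (2 * j) * (2 * Delta ^ 5 * A +
      6 * Delta ^ 4 * A ^ 2 + 8 * Delta ^ 3 * A ^ 3 + 6 * Delta ^ 2 * A ^ 4 +
      2 * Delta * A ^ 5) * charTwo
  rw [pow_one, pow_zero, one_mul] at h2
  rw [mul_add, h2, h3, ← add_sq_eq]
  congr 1
  ring

theorem heckePow_zero : heckePow 0 = 0 := by
  rw [heckePow_eq, pow_zero, pow_zero]
  have : dissect 1 = 1 := by
    ext n
    rw [coeff_dissect, coeff_one, coeff_one]
    simp
  rw [this]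
  linear_combination charTwo

theorem heckePow_one : heckePow 1 = 0 := by
  classical
  rw [heckePow_eq, pow_one, pow_one]
  ext n
  rw [map_add, coeff_dissect, coeff_expand, map_zero]
  simp only [Delta, coeff_mk]
  -- This says U₅Δ = Δ(q⁵), so the two halves of T₅Δ cancel.
  have key : (∃ m : ℕ, 5 * n = (2 * m + 1) ^ 2) ↔ 5 ∣ n ∧ ∃ m : ℕ, n / 5 = (2 * m + 1) ^ 2 := by
    constructor
    · rintro ⟨m, hm⟩
      obtain ⟨c, hc⟩ : 5 ∣ 2 * m + 1 := Nat.prime_five.dvd_of_dvd_pow ⟨n, hm.symm⟩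
      rw [hc] at hm
      have hn : n = 5 * c ^ 2 := by nlinarith
      refine ⟨⟨_, hn⟩, c / 2, ?_⟩
      rw [hn, Nat.mul_div_cancel_left _ (by norm_num)]
      congr 1
      omega
    · rintro ⟨⟨c, rfl⟩, m, hm⟩
      rw [Nat.mul_div_cancel_left _ (by norm_num)] at hm
      exact ⟨5 * m + 2, by rw [hm]; ring⟩
  simp only [key]
  by_cases h5 : 5 ∣ n
  · simp only [h5, true_and, if_true]
    split_ifs
    · decide
    · decide
  · simp [h5]

theorem heckePow_two : heckePow 2 = 0 := by
  rw [heckePow_two_mul 1, heckePow_one, zero_pow two_ne_zero]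

theorem heckePow_three : heckePow 3 = 0 := by
  have h := Delta_mul_heckePow 0
  simp only [mul_zero, zero_add, heckePow_zero, heckePow_one, heckePow_two, add_zero] at h
  exact pow_eq_zero_iff two_ne_zero |>.mp h.symm

theorem heckePow_four : heckePow 4 = 0 := by
  rw [heckePow_two_mul 2, heckePow_two, zero_pow two_ne_zero]

/-- The quadratic relation degenerates to ΔF = F² for F = T₅(Δ⁵), and F ≠ 0 because its
q-coefficient is 1. -/
theorem heckePow_five : heckePow 5 = Delta := by
  have h := Delta_mul_heckePow 2
  simp only [Nat.reduceMul, Nat.reduceAdd, heckePow_two, heckePow_three, heckePow_four, mul_zero,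
    add_zero] at h
  have h5 : heckePow 5 ≠ 0 := by
    intro h0
    have h1 : coeff 1 (heckePow 5) = 1 := by
      rw [heckePow_eq, map_add, coeff_dissect, ← map_pow,
        coeff_expand_of_not_dvd _ _ _ (by norm_num),
        add_zero, mul_one, coeff_Delta_pow_self]
    rw [h0, map_zero] at h1
    exact zero_ne_one h1
  rw [pow_two] at h
  exact (mul_right_cancel₀ h5 h).symm

/-- The polynomials `p_k` with `T₅(Δ^k) = p_k(Δ)`. -/
noncomputable def tpoly : ℕ → Polynomial (ZMod 2)
  | 0 => 0
  | 1 => 0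
  | 2 => 0
  | 3 => 0
  | 4 => 0
  | 5 => Polynomial.X
  | k + 6 => Polynomial.X ^ 2 * tpoly (k + 4) + Polynomial.X ^ 4 * tpoly (k + 2) +
      Polynomial.X * tpoly (k + 1) + Polynomial.X ^ 6 * tpoly k

theorem aeval_tpoly (k : ℕ) : Polynomial.aeval Delta (tpoly k) = heckePow k := by
  induction k using Nat.strong_induction_on with
  | _ k ih =>
    match k with
    | 0 => simp [tpoly, heckePow_zero]
    | 1 => simp [tpoly, heckePow_one]
    | 2 => simp [tpoly, heckePow_two]
    | 3 => simp [tpoly, heckePow_three]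
    | 4 => simp [tpoly, heckePow_four]
    | 5 => simp [tpoly, heckePow_five]
    | k + 6 =>
      rw [heckePow_add_six, tpoly]
      simp only [map_add, map_mul, map_pow, Polynomial.aeval_X]
      rw [ih (k + 4) (by omega), ih (k + 2) (by omega), ih (k + 1) (by omega), ih k (by omega)]

/-- Δ^k begins with q^k, so the lowest term of a polynomial survives evaluation. -/
theorem aeval_Delta_injective :
    Function.Injective (Polynomial.aeval Delta : Polynomial (ZMod 2) →ₐ[ZMod 2] _) := by
  rw [injective_iff_map_eq_zero]
  intro f hf
  by_contra h0
  have h := congrArg (coeff f.natTrailingDegree) hf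
  rw [Polynomial.aeval_eq_sum_range, map_sum, map_zero,
    Finset.sum_eq_single_of_mem f.natTrailingDegree] at h
  · rw [map_smul, coeff_Delta_pow_self] at h
    refine h0 (Polynomial.trailingCoeff_eq_zero.mp ?_)
    simpa using h
  · rw [Finset.mem_range, Nat.lt_succ_iff]
    exact Polynomial.natTrailingDegree_le_natDegree f
  · intro j _ hj
    rcases lt_or_gt_of_ne hj with hlt | hgt
    · rw [Polynomial.coeff_eq_zero_of_lt_natTrailingDegree hlt, zero_smul, map_zero]
    · rw [map_smul, coeff_Delta_pow_of_lt hgt, smul_zero]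

theorem tpoly_two_mul (k : ℕ) : tpoly (2 * k) = tpoly k ^ 2 := by
  apply aeval_Delta_injective
  rw [map_pow, aeval_tpoly, aeval_tpoly, heckePow_two_mul]

theorem X_mul_tpoly (j : ℕ) :
    Polynomial.X * tpoly (2 * j + 1) = (tpoly (j + 3) + Polynomial.X * tpoly (j + 2) +
      Polynomial.X ^ 2 * tpoly (j + 1) + Polynomial.X ^ 3 * tpoly j) ^ 2 := by
  apply aeval_Delta_injective
  simp only [map_mul, map_add, map_pow, Polynomial.aeval_X, aeval_tpoly, Delta_mul_heckePow]

end ModTwo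

/-! ### Codes, weights and binary digits. -/

namespace ModTwo

theorem n3_two_mul_add_one (j N : ℕ) (hN : 2 * j + 1 ≤ N) :
    n3 (2 * j + 1) = ∑ i ∈ Finset.range N, (j.testBit (2 * i)).toNat * 2 ^ i := by
  rw [n3, testBit_sum_extend _ N _ hN]
  simp only [Nat.testBit_succ, show (2 * j + 1) / 2 = j by omega]

theorem n5_two_mul_add_one (j N : ℕ) (hN : 2 * j + 1 ≤ N) :
    n5 (2 * j + 1) = ∑ i ∈ Finset.range N, (j.testBit (2 * i + 1)).toNat * 2 ^ i := by
  rw [n5, testBit_sum_extend _ N _ hN]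
  refine Finset.sum_congr rfl fun i _ => ?_
  rw [show 2 * i + 2 = (2 * i + 1) + 1 by rfl, Nat.testBit_succ (2 * j + 1),
    show (2 * j + 1) / 2 = j by omega]

/-- Appending a low digit to the index shifts all positions by one, so n₃ and n₅ exchange roles.
This is why squaring a polynomial exchanges the two weights below. -/
theorem n5_bit (a b : ℕ) (hb : b < 2) : n5 (2 * (2 * a + b) + 1) = n3 (2 * a + 1) := by
  rw [n5_two_mul_add_one _ _ le_rfl, n3_two_mul_add_one a (2 * (2 * a + b) + 1) (by omega)]
  simp only [Nat.testBit_succ, show (2 * a + b) / 2 = a by omega]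

theorem n3_bit (a b : ℕ) (hb : b < 2) :
    n3 (2 * (2 * a + b) + 1) = b + 2 * n5 (2 * a + 1) := by
  rw [n3_two_mul_add_one _ (2 * (2 * a + b) + 1 + 1) (by omega),
    n5_two_mul_add_one a (2 * (2 * a + b) + 1) (by omega), Finset.sum_range_succ',
    Finset.mul_sum, add_comm]
  congr 1
  · have : b = 0 ∨ b = 1 := by omega
    rcases this with rfl | rfl <;> simp [Nat.testBit_zero]
  · refine Finset.sum_congr rfl fun i _ => ?_
    rw [show 2 * (i + 1) = (2 * i + 1) + 1 by ring, Nat.testBit_succ (2 * a + b),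
      show (2 * a + b) / 2 = a by omega, pow_succ]
    ring

/-- The height `n₃ + n₅` of the exponent `2j + 1`. -/
def wt (j : ℕ) : ℕ := n3 (2 * j + 1) + n5 (2 * j + 1)

/-- The weight `n₃ + 2 n₅` of the exponent `2j + 1`. -/
def wt' (j : ℕ) : ℕ := n3 (2 * j + 1) + 2 * n5 (2 * j + 1)

theorem wt_bit (a b : ℕ) (hb : b < 2) : wt (2 * a + b) = wt' a + b := by
  rw [wt, wt', n3_bit a b hb, n5_bit a b hb]
  ring

theorem wt'_bit (a b : ℕ) (hb : b < 2) : wt' (2 * a + b) = 2 * wt a + b := by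
  rw [wt, wt', n3_bit a b hb, n5_bit a b hb]
  ring

theorem wt_two_mul (a : ℕ) : wt (2 * a) = wt' a := wt_bit a 0 two_pos

theorem wt'_two_mul (a : ℕ) : wt' (2 * a) = 2 * wt a := wt'_bit a 0 two_pos

theorem wt_two_mul_add_one (a : ℕ) : wt (2 * a + 1) = wt' a + 1 := wt_bit a 1 one_lt_two

theorem wt'_two_mul_add_one (a : ℕ) : wt' (2 * a + 1) = 2 * wt a + 1 := wt'_bit a 1 one_lt_two

theorem wt_four_mul_add (a b : ℕ) (hb : b < 4) : wt (4 * a + b) = 2 * wt a + b / 2 + b % 2 := by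
  rw [show 4 * a + b = 2 * (2 * a + b / 2) + b % 2 by omega, wt_bit _ _ (by omega),
    wt'_bit _ _ (by omega)]

theorem wt'_four_mul_add (a b : ℕ) (hb : b < 4) : wt' (4 * a + b) = 2 * wt' a + b := by
  rw [show 4 * a + b = 2 * (2 * a + b / 2) + b % 2 by omega, wt'_bit _ _ (by omega),
    wt_bit _ _ (by omega)]
  omega

/-- A carry passes from one weight to the other, so the two bounds need a joint induction. -/
theorem wt_wt'_add_one (a : ℕ) : wt (a + 1) ≤ wt a + 1 ∧ wt' (a + 1) ≤ wt' a + 1 := by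
  induction a using Nat.strong_induction_on with
  | _ a ih =>
    rcases Nat.even_or_odd' a with ⟨c, rfl | rfl⟩
    · rw [wt_two_mul_add_one, wt'_two_mul_add_one, wt_two_mul, wt'_two_mul]
      exact ⟨le_rfl, le_rfl⟩
    · have := ih c (by omega)
      rw [show 2 * c + 1 + 1 = 2 * (c + 1) by ring, wt_two_mul_add_one, wt'_two_mul_add_one,
        wt_two_mul, wt'_two_mul]
      omega

theorem wt_wt'_add_two (a : ℕ) : wt (a + 2) ≤ wt a + 1 ∧ wt' (a + 2) ≤ wt' a + 2 := by
  obtain ⟨c, b, hb, rfl⟩ : ∃ c b, b < 2 ∧ a = 2 * c + b := ⟨a / 2, a % 2, by omega, by omega⟩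
  have h := wt_wt'_add_one c
  rw [show 2 * c + b + 2 = 2 * (c + 1) + b by ring, wt_bit _ _ hb, wt'_bit _ _ hb, wt_bit _ _ hb,
    wt'_bit _ _ hb]
  omega

/-! ### Weight bounds on polynomial supports. -/

open Polynomial

/-- Every exponent `a` occurring in `f` satisfies `w a ≤ c`. -/
def SuppLE (w : ℕ → ℕ) (f : (ZMod 2)[X]) (c : ℤ) : Prop := ∀ a, f.coeff a ≠ 0 → (w a : ℤ) ≤ c

namespace SuppLE

variable {w : ℕ → ℕ} {f g : (ZMod 2)[X]} {c d : ℤ}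

theorem zero : SuppLE w 0 c := fun a h => absurd (coeff_zero a) h

theorem mono (hf : SuppLE w f c) (h : c ≤ d) : SuppLE w f d := fun a ha => (hf a ha).trans h

theorem add (hf : SuppLE w f c) (hg : SuppLE w g c) : SuppLE w (f + g) c := by
  intro a ha
  by_cases h : f.coeff a = 0
  · refine hg a fun h' => ha ?_
    rw [coeff_add, h, h', add_zero]
  · exact hf a h

theorem coeff_eq_zero (hf : SuppLE w f c) {a : ℕ} (h : c < w a) : f.coeff a = 0 := by
  by_contra h'
  exact absurd (hf a h') (not_le.mpr h)

theorem X_pow_mul (b : ℕ) (hf : SuppLE w f c) (h : ∀ a, (w (a + b) : ℤ) ≤ w a + d) :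
    SuppLE w (X ^ b * f) (c + d) := by
  intro a ha
  rw [coeff_X_pow_mul'] at ha
  split_ifs at ha with hab
  · have h1 := h (a - b)
    rw [Nat.sub_add_cancel hab] at h1
    linarith [hf _ ha]
  · exact absurd rfl ha

end SuppLE

theorem coeff_X_pow_mul_sq (f : (ZMod 2)[X]) (b a : ℕ) :
    (X ^ b * f ^ 2).coeff (2 * a + b) = f.coeff a := by
  rw [← ZMod.expand_card f, coeff_X_pow_mul, mul_comm, coeff_expand_mul two_pos]

theorem exists_of_coeff_X_pow_mul_sq_ne_zero {f : (ZMod 2)[X]} {b n : ℕ}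
    (h : (X ^ b * f ^ 2).coeff n ≠ 0) : ∃ a, n = 2 * a + b ∧ f.coeff a ≠ 0 := by
  rw [← ZMod.expand_card f, coeff_X_pow_mul'] at h
  split_ifs at h with hb
  · rw [coeff_expand two_pos] at h
    split_ifs at h with h2
    · exact ⟨(n - b) / 2, by omega, h⟩
    · exact absurd rfl h
  · exact absurd rfl h

theorem coeff_X_pow_mul_pow_four (f : (ZMod 2)[X]) (b a : ℕ) :
    (X ^ b * f ^ 4).coeff (4 * a + b) = f.coeff a := by
  rw [show f ^ 4 = (X ^ 0 * f ^ 2) ^ 2 by ring, show 4 * a + b = 2 * (2 * a + 0) + b by ring,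
    coeff_X_pow_mul_sq, coeff_X_pow_mul_sq]

theorem exists_of_coeff_X_pow_mul_pow_four_ne_zero {f : (ZMod 2)[X]} {b n : ℕ}
    (h : (X ^ b * f ^ 4).coeff n ≠ 0) : ∃ a, n = 4 * a + b ∧ f.coeff a ≠ 0 := by
  rw [show f ^ 4 = (X ^ 0 * f ^ 2) ^ 2 by ring] at h
  obtain ⟨a, rfl, ha⟩ := exists_of_coeff_X_pow_mul_sq_ne_zero h
  obtain ⟨c, rfl, hc⟩ := exists_of_coeff_X_pow_mul_sq_ne_zero ha
  exact ⟨c, by ring, hc⟩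

theorem SuppLE.sq_wt {f : (ZMod 2)[X]} {c : ℤ} (b : ℕ) (hb : b < 2) (hf : SuppLE wt' f c) :
    SuppLE wt (X ^ b * f ^ 2) (c + b) := by
  intro n hn
  obtain ⟨a, rfl, ha⟩ := exists_of_coeff_X_pow_mul_sq_ne_zero hn
  rw [wt_bit _ _ hb]
  push_cast
  linarith [hf a ha]

theorem SuppLE.sq_wt' {f : (ZMod 2)[X]} {c : ℤ} (b : ℕ) (hb : b < 2) (hf : SuppLE wt f c) :
    SuppLE wt' (X ^ b * f ^ 2) (2 * c + b) := by
  intro n hn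
  obtain ⟨a, rfl, ha⟩ := exists_of_coeff_X_pow_mul_sq_ne_zero hn
  rw [wt'_bit _ _ hb]
  push_cast
  linarith [hf a ha]

theorem SuppLE.pow_four_wt {f : (ZMod 2)[X]} {c : ℤ} (b : ℕ) (hb : b < 4) (hf : SuppLE wt f c) :
    SuppLE wt (X ^ b * f ^ 4) (2 * c + (b / 2 + b % 2 : ℕ)) := by
  intro n hn
  obtain ⟨a, rfl, ha⟩ := exists_of_coeff_X_pow_mul_pow_four_ne_zero hn
  rw [wt_four_mul_add _ _ hb]
  push_cast
  linarith [hf a ha]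

theorem SuppLE.pow_four_wt' {f : (ZMod 2)[X]} {c : ℤ} (b : ℕ) (hb : b < 4)
    (hf : SuppLE wt' f c) : SuppLE wt' (X ^ b * f ^ 4) (2 * c + b) := by
  intro n hn
  obtain ⟨a, rfl, ha⟩ := exists_of_coeff_X_pow_mul_pow_four_ne_zero hn
  rw [wt'_four_mul_add _ _ hb]
  push_cast
  linarith [hf a ha]

theorem SuppLE.X_mul_wt {f : (ZMod 2)[X]} {c : ℤ} (hf : SuppLE wt f c) :
    SuppLE wt (X * f) (c + 1) := by
  rw [← pow_one X]
  exact hf.X_pow_mul 1 fun a => by exact_mod_cast (wt_wt'_add_one a).1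

theorem SuppLE.X_mul_wt' {f : (ZMod 2)[X]} {c : ℤ} (hf : SuppLE wt' f c) :
    SuppLE wt' (X * f) (c + 1) := by
  rw [← pow_one X]
  exact hf.X_pow_mul 1 fun a => by exact_mod_cast (wt_wt'_add_one a).2

theorem SuppLE.X_sq_mul_wt {f : (ZMod 2)[X]} {c : ℤ} (hf : SuppLE wt f c) :
    SuppLE wt (X ^ 2 * f) (c + 1) :=
  hf.X_pow_mul 2 fun a => by exact_mod_cast (wt_wt'_add_two a).1

theorem SuppLE.X_sq_mul_wt' {f : (ZMod 2)[X]} {c : ℤ} (hf : SuppLE wt' f c) :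
    SuppLE wt' (X ^ 2 * f) (c + 2) :=
  hf.X_pow_mul 2 fun a => by exact_mod_cast (wt_wt'_add_two a).2

/-! ### Twofold and fourfold recursions for R_j. -/

theorem coeff_zero_tpoly (k : ℕ) : (tpoly k).coeff 0 = 0 := by
  match k with
  | 0 | 1 | 2 | 3 | 4 | 5 => simp [tpoly]
  | k + 6 => simp [tpoly, pow_succ, mul_assoc, mul_coeff_zero]

/-- The quotient of `p_{i+1}` by `X`. -/
noncomputable def epoly (i : ℕ) : (ZMod 2)[X] := divX (tpoly (i + 1))

theorem X_mul_epoly (i : ℕ) : X * epoly i = tpoly (i + 1) := by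
  have := X_mul_divX_add (tpoly (i + 1))
  rwa [coeff_zero_tpoly, map_zero, add_zero] at this

/-- The polynomials `R_j` with `T₅(Δ^{2j+1}) = Δ R_j(Δ²)`. -/
noncomputable def rpoly (j : ℕ) : (ZMod 2)[X] :=
  epoly (j + 2) + tpoly (j + 2) + X * tpoly (j + 1) + X ^ 2 * tpoly j

theorem tpoly_odd (j : ℕ) : tpoly (2 * j + 1) = X * rpoly j ^ 2 := by
  apply mul_left_cancel₀ (X_ne_zero (R := ZMod 2))
  rw [X_mul_tpoly, ← X_mul_epoly (j + 2), rpoly]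
  ring

theorem epoly_even (c : ℕ) : epoly (2 * c) = rpoly c ^ 2 := by
  apply mul_left_cancel₀ (X_ne_zero (R := ZMod 2))
  rw [X_mul_epoly, tpoly_odd]

theorem epoly_odd (c : ℕ) : epoly (2 * c + 1) = X * epoly c ^ 2 := by
  apply mul_left_cancel₀ (X_ne_zero (R := ZMod 2))
  rw [X_mul_epoly, show 2 * c + 1 + 1 = 2 * (c + 1) by ring, tpoly_two_mul, ← X_mul_epoly]
  ring

theorem rpoly_even (i : ℕ) : rpoly (2 * i) =
    rpoly (i + 1) ^ 2 + tpoly (i + 1) ^ 2 + X ^ 2 * rpoly i ^ 2 + X ^ 2 * tpoly i ^ 2 := by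
  rw [rpoly, show 2 * i + 2 = 2 * (i + 1) by ring, epoly_even, tpoly_two_mul, tpoly_odd,
    tpoly_two_mul]
  ring

theorem rpoly_odd (i : ℕ) : rpoly (2 * i + 1) =
    X * epoly (i + 1) ^ 2 + X * rpoly (i + 1) ^ 2 + X * tpoly (i + 1) ^ 2 +
      X ^ 3 * rpoly i ^ 2 := by
  rw [rpoly, show 2 * i + 1 + 2 = 2 * (i + 1) + 1 by ring, epoly_odd, tpoly_odd,
    show 2 * i + 1 + 1 = 2 * (i + 1) by ring, tpoly_two_mul, tpoly_odd]
  ring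

theorem poly_two : (2 : (ZMod 2)[X]) = 0 := by
  have : ((2 : ZMod 2)) = 0 := by decide
  rw [← map_ofNat (C : ZMod 2 →+* (ZMod 2)[X]) 2, this, map_zero]

/-- In the iterated recursion the fourth powers of R_{i+1} and p_{i+1} occur twice and cancel. The
last two summands stay grouped because their sum obeys the sharper bound `epoly_add_bound`. -/
theorem rpoly_four_mul (i : ℕ) : rpoly (4 * i) =
    X ^ 2 * (rpoly i + tpoly i + (epoly (i + 1) + X * tpoly i)) ^ 4 := by
  rw [show 4 * i = 2 * (2 * i) by ring, rpoly_even, rpoly_odd, tpoly_odd, rpoly_even,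
    tpoly_two_mul, show ∀ f : (ZMod 2)[X], f ^ 4 = (f ^ 2) ^ 2 by intro f; ring]
  simp only [CharTwo.add_sq, mul_pow]
  linear_combination (X ^ 2 * rpoly (i + 1) ^ 4 + X ^ 2 * tpoly (i + 1) ^ 4 +
    X ^ 6 * rpoly i ^ 4) * poly_two

theorem rpoly_four_mul_add_one (i : ℕ) : rpoly (4 * i + 1) =
    X ^ 3 * (rpoly i + epoly i + (epoly (i + 1) + X * tpoly i)) ^ 4 := by
  rw [show 4 * i + 1 = 2 * (2 * i) + 1 by ring, rpoly_odd, rpoly_odd, epoly_odd, tpoly_odd,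
    rpoly_even, show ∀ f : (ZMod 2)[X], f ^ 4 = (f ^ 2) ^ 2 by intro f; ring]
  simp only [CharTwo.add_sq, mul_pow]
  linear_combination (X ^ 3 * rpoly (i + 1) ^ 4 + X ^ 3 * tpoly (i + 1) ^ 4 +
    X ^ 7 * rpoly i ^ 4) * poly_two

/-- The grouping isolates R_{i+2} + X²R_i, the part that carries the leading term. -/
theorem rpoly_four_mul_add_two (i : ℕ) : rpoly (4 * i + 2) =
    X ^ 0 * (rpoly (i + 2) + X ^ 2 * rpoly i + (tpoly (i + 1) + X * rpoly i)) ^ 4 := by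
  rw [show 4 * i + 2 = 2 * (2 * i + 1) by ring, rpoly_even,
    show 2 * i + 1 + 1 = 2 * (i + 1) by ring, rpoly_even, rpoly_odd, tpoly_odd, tpoly_two_mul,
    show ∀ f : (ZMod 2)[X], f ^ 4 = (f ^ 2) ^ 2 by intro f; ring, ← X_mul_epoly (i + 1)]
  simp only [CharTwo.add_sq, mul_pow]
  linear_combination (X ^ 4 * epoly (i + 1) ^ 4 + X ^ 4 * rpoly (i + 1) ^ 4 +
    X ^ 4 * tpoly (i + 1) ^ 4) * poly_two

theorem rpoly_four_mul_add_three (i : ℕ) : rpoly (4 * i + 3) =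
    X ^ 1 * (rpoly (i + 2) + X ^ 2 * rpoly i + (tpoly (i + 1) + rpoly (i + 1))) ^ 4 := by
  rw [show 4 * i + 3 = 2 * (2 * i + 1) + 1 by ring, rpoly_odd,
    show 2 * i + 1 + 1 = 2 * (i + 1) by ring, epoly_even, rpoly_even, rpoly_odd, tpoly_two_mul,
    show ∀ f : (ZMod 2)[X], f ^ 4 = (f ^ 2) ^ 2 by intro f; ring, ← X_mul_epoly (i + 1)]
  simp only [CharTwo.add_sq, mul_pow]
  linear_combination (X ^ 5 * epoly (i + 1) ^ 4 + X ^ 5 * rpoly (i + 1) ^ 4 +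
    X ^ 5 * tpoly (i + 1) ^ 4) * poly_two

end ModTwo

/-! ### Upper bounds for both weights. -/

namespace ModTwo

open Polynomial

/-- The two weight bounds satisfied by `R_j`. -/
def RBound (j : ℕ) : Prop := SuppLE wt (rpoly j) (wt j - 1) ∧ SuppLE wt' (rpoly j) (wt' j - 2)

theorem tpoly_bound (i : ℕ) (hR : ∀ j, 2 * j + 1 ≤ i → RBound j) :
    SuppLE wt (tpoly i) (wt i - 2) ∧ SuppLE wt' (tpoly i) (wt' i - 2) := by
  induction i using Nat.strong_induction_on with
  | _ i ih =>
    rcases Nat.even_or_odd' i with ⟨c, rfl | rfl⟩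
    · rcases Nat.eq_zero_or_pos c with rfl | hc
      · exact ⟨SuppLE.zero, SuppLE.zero⟩
      · obtain ⟨h1, h2⟩ := ih c (by omega) fun j hj => hR j (by omega)
        rw [tpoly_two_mul, wt_two_mul, wt'_two_mul, ← one_mul (tpoly c ^ 2), ← pow_zero X]
        refine ⟨(h2.sq_wt 0 two_pos).mono ?_, (h1.sq_wt' 0 two_pos).mono ?_⟩ <;> push_cast <;>
          linarith
    · obtain ⟨h1, h2⟩ := hR c le_rfl
      rw [tpoly_odd, wt_two_mul_add_one, wt'_two_mul_add_one, ← pow_one X]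
      refine ⟨(h2.sq_wt 1 one_lt_two).mono ?_, (h1.sq_wt' 1 one_lt_two).mono ?_⟩ <;> push_cast <;>
        linarith

theorem epoly_bound (i : ℕ) (hR : ∀ j, 2 * j ≤ i → RBound j) :
    SuppLE wt (epoly i) (wt i - 2) ∧ SuppLE wt' (epoly i) (wt' i - 2) := by
  induction i using Nat.strong_induction_on with
  | _ i ih =>
    rcases Nat.even_or_odd' i with ⟨c, rfl | rfl⟩
    · obtain ⟨h1, h2⟩ := hR c le_rfl
      rw [epoly_even, wt_two_mul, wt'_two_mul, ← one_mul (rpoly c ^ 2), ← pow_zero X]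
      refine ⟨(h2.sq_wt 0 two_pos).mono ?_, (h1.sq_wt' 0 two_pos).mono ?_⟩ <;> push_cast <;>
        linarith
    · obtain ⟨h1, h2⟩ := ih c (by omega) fun j hj => hR j (by omega)
      rw [epoly_odd, wt_two_mul_add_one, wt'_two_mul_add_one, ← pow_one X]
      refine ⟨(h2.sq_wt 1 one_lt_two).mono ?_, (h1.sq_wt' 1 one_lt_two).mono ?_⟩ <;> push_cast <;>
        linarith

/-- The general bounds on the summands give only wt' i − 1. For even i, both are X times squares,
and the `wt` bounds suffice. For odd i = 2m + 1, the sum is R_{2m} plus smaller squares, and the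
bound on R_{2m} supplies the saving. -/
theorem epoly_add_bound (i : ℕ) (hR : ∀ j ≤ i, RBound j) :
    SuppLE wt' (epoly (i + 1) + X * tpoly i) (wt' i - 3) := by
  rcases Nat.even_or_odd' i with ⟨m, rfl | rfl⟩
  · have h1 := (epoly_bound m fun j hj => hR j (by omega)).1
    have h2 := (tpoly_bound m fun j hj => hR j (by omega)).1
    rw [epoly_odd, tpoly_two_mul, wt'_two_mul, ← pow_one X]
    refine ((h1.sq_wt' 1 one_lt_two).mono ?_).add ((h2.sq_wt' 1 one_lt_two).mono ?_) <;>
      push_cast <;> linarith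
  · have e : epoly (2 * m + 1 + 1) + X * tpoly (2 * m + 1) = rpoly (2 * m) +
        X ^ 0 * tpoly (m + 1) ^ 2 + X ^ 2 * (X ^ 0 * tpoly m ^ 2) := by
      rw [show 2 * m + 1 + 1 = 2 * (m + 1) by ring, epoly_even, tpoly_odd, rpoly_even]
      linear_combination (-(tpoly (m + 1) ^ 2 + X ^ 2 * tpoly m ^ 2)) * poly_two
    have h1 := (hR (2 * m) (by omega)).2
    have h2 := (tpoly_bound (m + 1) fun j hj => hR j (by omega)).1
    have h3 := (tpoly_bound m fun j hj => hR j (by omega)).1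
    have h4 : (wt (m + 1) : ℤ) ≤ wt m + 1 := by exact_mod_cast (wt_wt'_add_one m).1
    rw [wt'_two_mul] at h1
    rw [e, wt'_two_mul_add_one]
    refine ((h1.mono ?_).add ((h2.sq_wt' 0 two_pos).mono ?_)).add
      ((h3.sq_wt' 0 two_pos).X_sq_mul_wt'.mono ?_) <;> push_cast <;> linarith

theorem rpoly_zero : rpoly 0 = 0 := by
  have h := X_mul_epoly 2
  rw [show tpoly (2 + 1) = 0 from rfl, mul_eq_zero] at h
  rw [rpoly, zero_add, zero_add, h.resolve_left X_ne_zero]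
  simp [tpoly]

theorem rpoly_two : rpoly 2 = 1 := by
  have h := X_mul_epoly 4
  rw [show tpoly (4 + 1) = X from rfl] at h
  rw [rpoly, mul_left_cancel₀ X_ne_zero (h.trans (mul_one X).symm)]
  simp [tpoly]

theorem wt_zero : wt 0 = 0 := by decide

theorem wt'_zero : wt' 0 = 0 := by decide

theorem rpoly_bound (n : ℕ) : RBound n := by
  induction n using Nat.strong_induction_on with
  | _ n ih =>
    obtain ⟨i, d, hd, rfl⟩ : ∃ i d, d < 4 ∧ n = 4 * i + d := ⟨n / 4, n % 4, by omega, by omega⟩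
    rw [RBound, wt_four_mul_add i d hd, wt'_four_mul_add i d hd]
    -- For indices 0 and 2 the fourfold recursion refers back to the same R_j, so these cases are
    -- computed directly.
    by_cases h0 : i = 0 ∧ d = 0
    · obtain ⟨rfl, rfl⟩ := h0
      rw [rpoly_zero]
      exact ⟨SuppLE.zero, SuppLE.zero⟩
    by_cases h2 : i = 0 ∧ d = 2
    · obtain ⟨rfl, rfl⟩ := h2
      rw [rpoly_two]
      constructor
      · intro a ha
        obtain rfl : a = 0 := by
          by_contra h
          exact ha (by simp [coeff_one, h])
        simp [wt_zero]
      · intro a ha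
        obtain rfl : a = 0 := by
          by_contra h
          exact ha (by simp [coeff_one, h])
        simp [wt'_zero]
    have a1 : (wt (i + 1) : ℤ) ≤ wt i + 1 := by exact_mod_cast (wt_wt'_add_one i).1
    have a2 : (wt' (i + 1) : ℤ) ≤ wt' i + 1 := by exact_mod_cast (wt_wt'_add_one i).2
    have a3 : (wt (i + 2) : ℤ) ≤ wt i + 1 := by exact_mod_cast (wt_wt'_add_two i).1
    have a4 : (wt' (i + 2) : ℤ) ≤ wt' i + 2 := by exact_mod_cast (wt_wt'_add_two i).2
    obtain ⟨r1, r2⟩ := ih i (by omega)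
    obtain ⟨t1, t2⟩ := tpoly_bound i fun j hj => ih j (by omega)
    obtain ⟨e1, e2⟩ := epoly_bound i fun j hj => ih j (by omega)
    obtain ⟨f1, f2⟩ := epoly_bound (i + 1) fun j hj => ih j (by omega)
    have q := epoly_add_bound i fun j hj => ih j (by omega)
    have cases : d = 0 ∨ d = 1 ∨ d = 2 ∨ d = 3 := by omega
    rcases cases with rfl | rfl | rfl | rfl
    · rw [add_zero, rpoly_four_mul]
      constructor
      · refine (SuppLE.pow_four_wt (c := wt i - 1) 2 (by norm_num) ?_).mono
          (by push_cast; linarith)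
        refine (r1.add (t1.mono ?_)).add ((f1.mono ?_).add (t1.X_mul_wt.mono ?_)) <;> linarith
      · refine (SuppLE.pow_four_wt' (c := wt' i - 2) 2 (by norm_num) ?_).mono
          (by push_cast; linarith)
        refine (r2.add t2).add (q.mono ?_)
        linarith
    · rw [rpoly_four_mul_add_one]
      constructor
      · refine (SuppLE.pow_four_wt (c := wt i - 1) 3 (by norm_num) ?_).mono
          (by push_cast; linarith)
        refine (r1.add (e1.mono ?_)).add ((f1.mono ?_).add (t1.X_mul_wt.mono ?_)) <;> linarith
      · refine (SuppLE.pow_four_wt' (c := wt' i - 2) 3 (by norm_num) ?_).mono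
          (by push_cast; linarith)
        refine (r2.add e2).add (q.mono ?_)
        linarith
    · obtain ⟨u1, u2⟩ := ih (i + 2) (by omega)
      obtain ⟨v1, v2⟩ := tpoly_bound (i + 1) fun j hj => ih j (by omega)
      rw [rpoly_four_mul_add_two]
      constructor
      · refine (SuppLE.pow_four_wt (c := wt i) 0 (by norm_num) ?_).mono (by push_cast; linarith)
        refine ((u1.mono ?_).add (r1.X_sq_mul_wt.mono ?_)).add
          ((v1.mono ?_).add (r1.X_mul_wt.mono ?_)) <;> linarith
      · refine (SuppLE.pow_four_wt' (c := wt' i) 0 (by norm_num) ?_).mono (by push_cast; linarith)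
        refine ((u2.mono ?_).add (r2.X_sq_mul_wt'.mono ?_)).add
          ((v2.mono ?_).add (r2.X_mul_wt'.mono ?_)) <;> linarith
    · obtain ⟨u1, u2⟩ := ih (i + 2) (by omega)
      obtain ⟨w1, w2⟩ := ih (i + 1) (by omega)
      obtain ⟨v1, v2⟩ := tpoly_bound (i + 1) fun j hj => ih j (by omega)
      rw [rpoly_four_mul_add_three]
      constructor
      · refine (SuppLE.pow_four_wt (c := wt i) 1 (by norm_num) ?_).mono (by push_cast; linarith)
        refine ((u1.mono ?_).add (r1.X_sq_mul_wt.mono ?_)).add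
          ((v1.mono ?_).add (w1.mono ?_)) <;> linarith
      · refine (SuppLE.pow_four_wt' (c := wt' i) 1 (by norm_num) ?_).mono (by push_cast; linarith)
        refine ((u2.mono ?_).add (r2.X_sq_mul_wt'.mono ?_)).add
          ((v2.mono ?_).add (w2.mono ?_)) <;> linarith

/-! ### The leading term of R_j. -/

theorem n3_four_mul_add (a b : ℕ) (hb : b < 4) :
    n3 (2 * (4 * a + b) + 1) = 2 * n3 (2 * a + 1) + b % 2 := by
  rw [show 4 * a + b = 2 * (2 * a + b / 2) + b % 2 by omega, n3_bit _ _ (by omega),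
    n5_bit _ _ (by omega)]
  ring

theorem n5_four_mul_add (a b : ℕ) (hb : b < 4) :
    n5 (2 * (4 * a + b) + 1) = 2 * n5 (2 * a + 1) + b / 2 := by
  rw [show 4 * a + b = 2 * (2 * a + b / 2) + b % 2 by omega, n5_bit _ _ (by omega),
    n3_bit _ _ (by omega)]
  ring

/-- Adding 2 clears the second binary digit, which loses 2, while the carry gains at most 2. -/
theorem wt'_le_of_bit (e b : ℕ) (hb : b < 2) : wt' (4 * e + 2 + b + 2) ≤ wt' (4 * e + 2 + b) := by
  rw [show 4 * e + 2 + b + 2 = 4 * (e + 1) + b by ring,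
    show 4 * e + 2 + b = 4 * e + (2 + b) by ring,
    wt'_four_mul_add _ _ (by omega), wt'_four_mul_add _ _ (by omega)]
  have := (wt_wt'_add_one e).2
  omega

/-- If the second binary digit of `j` is 0, then `R_j` has no term of degree `j - 2`. -/
theorem coeff_rpoly_eq_zero (k : ℕ) (hk : 2 ≤ k % 4) : (rpoly (k + 2)).coeff k = 0 := by
  refine (rpoly_bound (k + 2)).2.coeff_eq_zero ?_
  have := wt'_le_of_bit (k / 4) (k % 4 - 2) (by omega)
  rw [show 4 * (k / 4) + 2 + (k % 4 - 2) = k by omega] at this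
  omega

theorem eq_of_code_eq {a b : ℕ} (h3 : n3 (2 * a + 1) = n3 (2 * b + 1))
    (h5 : n5 (2 * a + 1) = n5 (2 * b + 1)) : a = b := by
  have := code_injective ⟨a, rfl⟩ ⟨b, rfl⟩ h3 h5
  omega

/-- For d = 0, 1 lowering n₅ needs a borrow: the leading degree a of R_i gives 4a + d + 2, since
2(n₅ − 1) + 1 = 2n₅ − 1. For d = 2, 3 it suffices to clear a digit, giving 4i + d − 2. -/
theorem exists_coeff_rpoly_eq_one (j : ℕ) (hj : 1 ≤ n5 (2 * j + 1)) :
    ∃ a, n3 (2 * a + 1) = n3 (2 * j + 1) ∧ n5 (2 * a + 1) + 1 = n5 (2 * j + 1) ∧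
      (rpoly j).coeff a = 1 := by
  induction j using Nat.strong_induction_on with
  | _ j ih =>
    obtain ⟨i, d, hd, rfl⟩ : ∃ i d, d < 4 ∧ j = 4 * i + d := ⟨j / 4, j % 4, by omega, by omega⟩
    obtain ⟨r1, r2⟩ := rpoly_bound i
    obtain ⟨t1, t2⟩ := tpoly_bound i fun j _ => rpoly_bound j
    obtain ⟨e1, e2⟩ := epoly_bound i fun j _ => rpoly_bound j
    have q := epoly_add_bound i fun j _ => rpoly_bound j
    obtain ⟨v1, v2⟩ := tpoly_bound (i + 1) fun j _ => rpoly_bound j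
    obtain ⟨w1, w2⟩ := rpoly_bound (i + 1)
    have a2 : (wt' (i + 1) : ℤ) ≤ wt' i + 1 := by exact_mod_cast (wt_wt'_add_one i).2
    rw [n5_four_mul_add _ _ hd] at hj
    rw [n3_four_mul_add _ _ hd, n5_four_mul_add _ _ hd]
    -- Exactly one summand contributes. If the second binary digit of i is 1, R_i has a term of
    -- degree i − 2; otherwise R_{i+2} has one of degree i. The other contribution vanishes, by
    -- `coeff_rpoly_eq_zero` or for degree reasons.
    have main : 2 ≤ d → (rpoly (i + 2) + X ^ 2 * rpoly i).coeff i = 1 := by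
      intro h2
      have ih2 : ∀ k, 2 ≤ k % 4 → k < 4 * i + d → (rpoly k).coeff (k - 2) = 1 := by
        intro k hk hki
        have e5 := n5_four_mul_add (k / 4) (k % 4) (by omega)
        rw [show 4 * (k / 4) + k % 4 = k by omega] at e5
        obtain ⟨a, ha3, ha5, ha⟩ := ih k hki (by omega)
        have f5 := n5_four_mul_add (k / 4) (k % 4 - 2) (by omega)
        have e3 := n3_four_mul_add (k / 4) (k % 4) (by omega)
        have f3 := n3_four_mul_add (k / 4) (k % 4 - 2) (by omega)
        rw [show 4 * (k / 4) + k % 4 = k by omega] at e3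
        rw [show 4 * (k / 4) + (k % 4 - 2) = k - 2 by omega] at f3 f5
        rwa [eq_of_code_eq (a := k - 2) (b := a) (by omega) (by omega)]
      rw [coeff_add, coeff_X_pow_mul']
      by_cases hi : 2 ≤ i % 4
      · rw [coeff_rpoly_eq_zero i hi, if_pos (by omega), ih2 i hi (by omega), zero_add]
      · have h1 : (rpoly (i + 2)).coeff i = 1 := by
          -- Here R_{i+2} is R_j itself, so the induction hypothesis is unavailable.
          by_cases h0 : i = 0 ∧ d = 2
          · rw [h0.1, rpoly_two, coeff_one_zero]
          · exact ih2 (i + 2) (by omega) (by omega)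
        rw [h1]
        split_ifs with h
        · have := coeff_rpoly_eq_zero (i - 2) (by omega)
          rw [show i - 2 + 2 = i by omega] at this
          rw [this, add_zero]
        · rw [add_zero]
    have cases : d = 0 ∨ d = 1 ∨ d = 2 ∨ d = 3 := by omega
    rcases cases with rfl | rfl | rfl | rfl
    · obtain ⟨a, ha3, ha5, ha⟩ := ih i
        (by rcases Nat.eq_zero_or_pos i with rfl | h
            · exact absurd hj (by decide)
            · omega) (by omega)
      refine ⟨4 * a + 2, ?_, ?_, ?_⟩
      · rw [n3_four_mul_add _ _ (by norm_num)]
        omega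
      · rw [n5_four_mul_add _ _ (by norm_num)]
        omega
      · rw [add_zero, rpoly_four_mul, coeff_X_pow_mul_pow_four, coeff_add, coeff_add, ha,
          t1.coeff_eq_zero, q.coeff_eq_zero, add_zero, add_zero]
        · unfold wt'; omega
        · unfold wt; omega
    · obtain ⟨a, ha3, ha5, ha⟩ := ih i (by omega) (by omega)
      refine ⟨4 * a + 3, ?_, ?_, ?_⟩
      · rw [n3_four_mul_add _ _ (by norm_num)]
        omega
      · rw [n5_four_mul_add _ _ (by norm_num)]
        omega
      · rw [rpoly_four_mul_add_one, coeff_X_pow_mul_pow_four, coeff_add, coeff_add, ha,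
          e1.coeff_eq_zero, q.coeff_eq_zero, add_zero, add_zero]
        · unfold wt'; omega
        · unfold wt; omega
    · refine ⟨4 * i + 0, ?_, ?_, ?_⟩
      · rw [n3_four_mul_add _ _ (by norm_num)]
      · rw [n5_four_mul_add _ _ (by norm_num)]
      · rw [rpoly_four_mul_add_two, coeff_X_pow_mul_pow_four, coeff_add, main le_rfl, coeff_add,
          v2.coeff_eq_zero (by linarith), r2.X_mul_wt'.coeff_eq_zero (by linarith), add_zero,
          add_zero]
    · refine ⟨4 * i + 1, ?_, ?_, ?_⟩
      · rw [n3_four_mul_add _ _ (by norm_num)]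
      · rw [n5_four_mul_add _ _ (by norm_num)]
      · rw [rpoly_four_mul_add_three, coeff_X_pow_mul_pow_four, coeff_add, main (by norm_num),
          coeff_add, v2.coeff_eq_zero (by linarith), w2.coeff_eq_zero (by linarith), add_zero,
          add_zero]

end ModTwo

/-! ### From the polynomials R_j to forms. -/

namespace ModTwo

open Polynomial

/-- The form `∑ c_i Δ^{2i+1}` attached to the polynomial `∑ c_i X^i`. -/
noncomputable def formOf (g : (ZMod 2)[X]) : PowerSeries (ZMod 2) := aeval Delta (X * g ^ 2)

theorem formOf_eq_sum (g : (ZMod 2)[X]) :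
    formOf g = ∑ i ∈ g.support, g.coeff i • Delta ^ (2 * i + 1) := by
  rw [formOf, ← ZMod.expand_card g, map_mul, aeval_X, expand_aeval, aeval_eq_sum_range,
    Finset.mul_sum]
  symm
  refine Finset.sum_subset_zero_on_sdiff ?_ ?_ ?_
  · intro i hi
    rw [Finset.mem_range, Nat.lt_succ_iff]
    exact le_natDegree_of_mem_supp i hi
  · intro i hi
    rw [Finset.mem_sdiff, mem_support_iff, not_not] at hi
    rw [hi.2, zero_smul, mul_zero]
  · intro i _
    rw [mul_smul_comm, ← pow_mul, pow_succ', mul_comm]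

theorem formOf_mem (g : (ZMod 2)[X]) : formOf g ∈ oddForms := by
  rw [formOf_eq_sum]
  exact Submodule.sum_mem _ fun i _ => Submodule.smul_mem _ _ (Submodule.subset_span ⟨i, rfl⟩)

theorem exponents_formOf (g : (ZMod 2)[X]) {f : oddForms}
    (hf : (f : PowerSeries (ZMod 2)) = formOf g) :
    exponents f = g.support.image fun i => 2 * i + 1 := by
  have h : linearIndependent_Delta_pow.repr f =
      Finsupp.onFinset g.support g.coeff fun a ha => mem_support_iff.mpr ha := by
    apply linearIndependent_Delta_pow.repr_eq
    rw [hf, formOf_eq_sum, Finsupp.linearCombination_apply, Finsupp.onFinset_sum]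
    simp
  rw [exponents, h]
  congr 1
  ext a
  simp

theorem exists_eq_formOf (f : oddForms) :
    ∃ g : (ZMod 2)[X], (f : PowerSeries (ZMod 2)) = formOf g := by
  obtain ⟨f, hf⟩ := f
  induction hf using Submodule.span_induction with
  | mem x hx =>
    obtain ⟨i, rfl⟩ := hx
    refine ⟨X ^ i, ?_⟩
    rw [formOf, ← pow_mul, ← pow_succ', map_pow, aeval_X, mul_comm]
  | zero => exact ⟨0, by simp [formOf]⟩
  | add x y _ _ hx hy =>
    obtain ⟨g, hg⟩ := hx
    obtain ⟨g', hg'⟩ := hy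
    refine ⟨g + g', ?_⟩
    simp only at hg hg' ⊢
    rw [hg, hg', formOf, formOf, formOf, CharTwo.add_sq, mul_add, map_add]
  | smul a x _ hx =>
    obtain ⟨g, hg⟩ := hx
    refine ⟨a • g, ?_⟩
    simp only at hg ⊢
    have ha : a ^ 2 = a := by revert a; decide
    rw [hg, formOf, formOf, _root_.smul_pow, ha, mul_smul_comm, map_smul]

/-- The action of `T₅` on polynomials, through `g ↦ formOf g`. -/
noncomputable def heckePoly (g : (ZMod 2)[X]) : (ZMod 2)[X] :=
  ∑ i ∈ g.support, g.coeff i • rpoly i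

theorem coeff_heckePoly (g : (ZMod 2)[X]) (a : ℕ) :
    (heckePoly g).coeff a = ∑ i ∈ g.support, g.coeff i * (rpoly i).coeff a := by
  simp [heckePoly]

theorem hecke_formOf (g : (ZMod 2)[X]) : hecke 5 (formOf g) = formOf (heckePoly g) := by
  have h1 : hecke 5 (formOf g) = ∑ i ∈ g.support, g.coeff i • heckePow (2 * i + 1) := by
    rw [formOf_eq_sum, hecke_five_eq, map_sum, map_sum, ← Finset.sum_add_distrib]
    refine Finset.sum_congr rfl fun i _ => ?_
    rw [map_smul, map_smul, heckePow, hecke_five_eq, smul_add]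
  have h2 : heckePoly g ^ 2 = ∑ i ∈ g.support, g.coeff i • rpoly i ^ 2 := by
    rw [heckePoly, CharTwo.sum_sq]
    refine Finset.sum_congr rfl fun i _ => ?_
    have ha : ∀ a : ZMod 2, a ^ 2 = a := by decide
    rw [_root_.smul_pow, ha]
  rw [h1, formOf, h2, Finset.mul_sum, map_sum]
  refine Finset.sum_congr rfl fun i _ => ?_
  rw [mul_smul_comm, map_smul, ← tpoly_odd, aeval_tpoly]

theorem h_two_mul_add_one (j : ℕ) : h (2 * j + 1) = wt j := rfl

theorem wt'_eq (j : ℕ) : wt' j = wt j + n5 (2 * j + 1) := by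
  unfold wt wt'
  ring

theorem exists_of_coeff_heckePoly_ne_zero {g : (ZMod 2)[X]} {a : ℕ}
    (ha : (heckePoly g).coeff a ≠ 0) : ∃ i ∈ g.support, (rpoly i).coeff a ≠ 0 := by
  rw [coeff_heckePoly] at ha
  obtain ⟨i, hi, h⟩ := Finset.exists_ne_zero_of_sum_ne_zero ha
  exact ⟨i, hi, right_ne_zero_of_mul h⟩

theorem hForm_eq_of_isDominantExponent {f : oddForms} {m : ℕ} (hm : IsDominantExponent f m) :
    hForm f = ((h m : ℤ) : WithBot ℤ) := by
  refine le_antisymm (Finset.sup_le fun k hk => ?_)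
    (Finset.le_sup (f := fun m => ((h m : ℤ) : WithBot ℤ)) hm.1)
  by_cases hkm : k = m
  · rw [hkm]
  · have := hm.2 k hk hkm
    unfold DominatedBy at this
    exact_mod_cast (show h k ≤ h m by omega)

/-- The dominant exponent of the image under `T₅` of a form with dominant exponent `2j + 1`. -/
theorem isDominantExponent_heckePoly {g : (ZMod 2)[X]} {j : ℕ} (hj : j ∈ g.support)
    (hdom : ∀ i ∈ g.support, i ≠ j → DominatedBy (2 * i + 1) (2 * j + 1))
    (h5 : 1 ≤ n5 (2 * j + 1)) :
    ∃ a ∈ (heckePoly g).support, n3 (2 * a + 1) = n3 (2 * j + 1) ∧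
      n5 (2 * a + 1) + 1 = n5 (2 * j + 1) ∧
      ∀ b ∈ (heckePoly g).support, b ≠ a → DominatedBy (2 * b + 1) (2 * a + 1) := by
  obtain ⟨a, ha3, ha5, ha⟩ := exists_coeff_rpoly_eq_one j h5
  have hwa : wt a + 1 = wt j := by unfold wt; omega
  refine ⟨a, ?_, ha3, ha5, ?_⟩
  · rw [mem_support_iff, coeff_heckePoly, Finset.sum_eq_single_of_mem j hj, ha, mul_one]
    · exact mem_support_iff.mp hj
    · intro i hi hij
      have hd := hdom i hi hij
      rw [DominatedBy, h_two_mul_add_one, h_two_mul_add_one] at hd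
      obtain ⟨b1, b2⟩ := rpoly_bound i
      -- Degree a attains both bounds for R_j: a smaller height of i is excluded by `wt`, an equal
      -- height with smaller n₅ by `wt'`.
      rcases hd with hd | ⟨hd, hd'⟩
      · rw [b1.coeff_eq_zero (by omega), mul_zero]
      · rw [b2.coeff_eq_zero (by rw [wt'_eq, wt'_eq]; omega), mul_zero]
  · intro b hb hba
    obtain ⟨i, hi, hib⟩ := exists_of_coeff_heckePoly_ne_zero (mem_support_iff.mp hb)
    have b1 := (rpoly_bound i).1 b hib
    have b2 := (rpoly_bound i).2 b hib
    rw [wt'_eq, wt'_eq] at b2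
    push_cast at b2
    have hle : wt i < wt j ∨ (wt i = wt j ∧ n5 (2 * i + 1) ≤ n5 (2 * j + 1)) := by
      by_cases hij : i = j
      · rw [hij]
        exact Or.inr ⟨rfl, le_rfl⟩
      · have hd := hdom i hi hij
        rw [DominatedBy, h_two_mul_add_one, h_two_mul_add_one] at hd
        omega
    rw [DominatedBy, h_two_mul_add_one, h_two_mul_add_one]
    -- If b has the height of a, then i has the height of j, and the `wt'` bound gives n₅ at b at
    -- most that at a; failure of dominance then forces equal codes.
    by_contra hcon
    refine hba (eq_of_code_eq ?_ ?_)
    · unfold wt at *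
      omega
    · omega

end ModTwo

theorem proposition4p4 (f : ModTwo.oddForms) (hf : f ≠ 0) (m₁ : ℕ)
    (hm₁ : ModTwo.IsDominantExponent f m₁) :
    ∃ hT : ModTwo.hecke 5 (f : PowerSeries (ZMod 2)) ∈ ModTwo.oddForms,
      ModTwo.hForm f = (((ModTwo.h m₁ : ℤ)) : WithBot ℤ) ∧
      ModTwo.hForm ⟨ModTwo.hecke 5 (f : PowerSeries (ZMod 2)), hT⟩
        ≤ (((ModTwo.h m₁ : ℤ) - 1 : ℤ) : WithBot ℤ) ∧
      (1 ≤ ModTwo.n5 m₁ →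
        ModTwo.hForm ⟨ModTwo.hecke 5 (f : PowerSeries (ZMod 2)), hT⟩
          = (((ModTwo.h m₁ : ℤ) - 1 : ℤ) : WithBot ℤ) ∧
        ∃ m : ℕ,
          ModTwo.IsDominantExponent ⟨ModTwo.hecke 5 (f : PowerSeries (ZMod 2)), hT⟩ m ∧
          ModTwo.n3 m = ModTwo.n3 m₁ ∧ ModTwo.n5 m = ModTwo.n5 m₁ - 1) := by
  obtain ⟨g, hg⟩ := ModTwo.exists_eq_formOf f
  have hTg : ModTwo.hecke 5 (f : PowerSeries (ZMod 2)) = ModTwo.formOf (ModTwo.heckePoly g) := by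
    rw [hg, ModTwo.hecke_formOf]
  have hT : ModTwo.hecke 5 (f : PowerSeries (ZMod 2)) ∈ ModTwo.oddForms :=
    hTg ▸ ModTwo.formOf_mem _
  have hexp := ModTwo.exponents_formOf g hg
  have hexpT := ModTwo.exponents_formOf (f := ⟨_, hT⟩) (ModTwo.heckePoly g) hTg
  have hhf := ModTwo.hForm_eq_of_isDominantExponent hm₁
  obtain ⟨hmem, hdom⟩ := hm₁
  rw [hexp] at hmem hdom
  obtain ⟨j, hj, rfl⟩ := Finset.mem_image.mp hmem
  have hdom' : ∀ i ∈ g.support, i ≠ j → ModTwo.DominatedBy (2 * i + 1) (2 * j + 1) :=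
    fun i hi hij => hdom _ (Finset.mem_image_of_mem _ hi) (by omega)
  refine ⟨hT, hhf, ?_, fun h5 => ?_⟩
  · rw [ModTwo.hForm, hexpT]
    refine Finset.sup_le fun k hk => ?_
    obtain ⟨a, ha, rfl⟩ := Finset.mem_image.mp hk
    obtain ⟨i, hi, hia⟩ :=
      ModTwo.exists_of_coeff_heckePoly_ne_zero (Polynomial.mem_support_iff.mp ha)
    have h1 := (ModTwo.rpoly_bound i).1 a hia
    have h2 : ModTwo.wt i ≤ ModTwo.wt j := by
      by_cases hij : i = j
      · rw [hij]
      · have := hdom' i hi hij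
        rw [ModTwo.DominatedBy, ModTwo.h_two_mul_add_one, ModTwo.h_two_mul_add_one] at this
        omega
    rw [ModTwo.h_two_mul_add_one, ModTwo.h_two_mul_add_one, WithBot.coe_le_coe]
    omega
  · obtain ⟨a, ha, ha3, ha5, hmax⟩ := ModTwo.isDominantExponent_heckePoly hj hdom' h5
    have hma : ModTwo.IsDominantExponent ⟨_, hT⟩ (2 * a + 1) := by
      rw [ModTwo.IsDominantExponent, hexpT]
      refine ⟨Finset.mem_image_of_mem _ ha, fun k hk hka => ?_⟩
      obtain ⟨b, hb, rfl⟩ := Finset.mem_image.mp hk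
      exact hmax b hb (by omega)
    refine ⟨?_, 2 * a + 1, hma, ha3, by omega⟩
    rw [ModTwo.hForm_eq_of_isDominantExponent hma, WithBot.coe_inj, ModTwo.h, ModTwo.h]
    omega
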